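/- Let $Q(x)=\tfrac32\,\mathrm{sech}^2(x/2)$, let $\alpha(x)=\tfrac13(\sinh x+x)$, an increasing bijection of $\mathbb R$, and put $\widetilde Q=Q\circ\alpha^{-1}$ and $V=2\widetilde Q^2(1-\widetilde Q)$. Let $L=-\partial_x^2+V$ on $L^2(\mathbb R)=L^2(\mathbb R;\mathbb C)$ with domain $H^2(\mathbb R)$. For an operator $T$, write $\sigma(T)$ for its spectrum and $\sigma_p(T)$ for its point spectrum (the set of its eigenvalues). Then there is $\mu_0>0$ such that $-\mu_0^2$ is the unique negative eigenvalue of $L$, and this eigenvalue is simple (its eigenspace is one-dimensional). Moreover, it has a $C^2$, everywhere positive eigenfunction $\phi_0$ with $\|\phi_0\|_{L^2}=1$ and $\phi_0'/\phi_0$ bounded, and the following hold. Put $$U=\phi_0\cdot\partial_x\cdot\phi_0^{-1}=\partial_x-\frac{\phi_0'}{\phi_0},\qquad U^*=-\phi_0^{-1}\cdot\partial_x\cdot\phi_0=-\partial_x-\frac{\phi_0'}{\phi_0},$$ both with domain $H^1(\mathbb R)$, and $$L_0=-\partial_x^2+V_0,\qquad V_0=2\Big(\frac{\phi_0'}{\phi_0}\Big)^2-2\mu_0^2-V,$$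 with domain $H^2(\mathbb R)$. Then: 1. $U^*$ is the Hilbert space adjoint of $U$, and, with equality of domains, $L=U^*U-\mu_0^2$ and $L_0=UU^*-\mu_0^2$. 2. $V_0(x)\ge 0$ for every $x\in\mathbb R$. Moreover $\sigma(L_0)\subseteq[0,\infty)$, and every eigenvalue of $L_0$ (if there is any) is strictly positive. 3. $\sigma_p(L_0)=\sigma_p(L)\setminus\{-\mu_0^2\}$. -/

import Mathlib

open MeasureTheory
open scoped ContDiff

noncomputable section

namespace KinkSpectrum

/-! ### Unbounded operators on a complex Hilbert space -/

section Operators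

variable {E : Type*} [NormedAddCommGroup E] [InnerProductSpace ℂ E]

/-- The natural domain `{u ∈ D(S) : S u ∈ D(T)}` of the composition `T S`. -/
def compDomain (T S : E →ₗ.[ℂ] E) : Submodule ℂ E :=
  (T.domain.comap S.toFun).map S.domain.subtype

theorem apply_mem_of_compDomain (T S : E →ₗ.[ℂ] E)
    (x : (S.domRestrict (compDomain T S)).domain) :
    S.domRestrict (compDomain T S) x ∈ T.domain := by
  obtain ⟨x, hx, hS⟩ := x
  obtain ⟨y, hy, rfl⟩ := hx
  have : S.domRestrict (compDomain T S) ⟨S.domain.subtype y, ⟨⟨y, hy, rfl⟩, hS⟩⟩ = S y :=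
    LinearPMap.domRestrict_apply rfl
  rw [this]
  exact hy

/-- The composition `T S` of two unbounded operators, on its natural domain. -/
def opComp (T S : E →ₗ.[ℂ] E) : E →ₗ.[ℂ] E :=
  T.comp (S.domRestrict (compDomain T S)) (apply_mem_of_compDomain T S)

theorem mem_opComp_graph_iff (T S : E →ₗ.[ℂ] E) (u w : E) :
    (u, w) ∈ (opComp T S).graph ↔ ∃ v, (u, v) ∈ S.graph ∧ (v, w) ∈ T.graph := by
  have key : ∀ x : (S.domRestrict (compDomain T S)).domain,
      S.domRestrict (compDomain T S) x = S ⟨x, x.2.2⟩ :=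
    fun x => LinearPMap.domRestrict_apply rfl
  simp only [LinearPMap.mem_graph_iff]
  constructor
  · rintro ⟨y, hy, h⟩
    have h2 := apply_mem_of_compDomain T S y
    have k := key y
    exact ⟨_, ⟨⟨y, y.2.2⟩, hy, rfl⟩, ⟨⟨_, h2⟩, k, h⟩⟩
  · rintro ⟨v, ⟨y, rfl, rfl⟩, ⟨z, hz, rfl⟩⟩
    have hy : S.toFun y ∈ T.domain := by
      change S y ∈ T.domain
      rw [← hz]
      exact z.2
    have hd : (y : E) ∈ (S.domRestrict (compDomain T S)).domain := ⟨⟨y, hy, rfl⟩, y.2⟩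
    refine ⟨⟨y, hd⟩, rfl, ?_⟩
    change T ⟨_, _⟩ = _
    congr 1
    exact Subtype.ext ((key ⟨y, hd⟩).trans hz.symm)

/-- The operator `T - c`, with the same domain as `T`. -/
def opSubConst (T : E →ₗ.[ℂ] E) (c : ℂ) : E →ₗ.[ℂ] E :=
  T - (c • (LinearMap.id : E →ₗ[ℂ] E)).toPMap ⊤

/-- The eigenspace `{u ∈ D(T) : T u = z u}`. -/
def eigenspace (T : E →ₗ.[ℂ] E) (z : ℂ) : Submodule ℂ E :=
  T.graph.comap (LinearMap.prod LinearMap.id (z • LinearMap.id))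

theorem mem_eigenspace_iff (T : E →ₗ.[ℂ] E) (z : ℂ) (u : E) :
    u ∈ eigenspace T z ↔ ∃ h : u ∈ T.domain, T ⟨u, h⟩ = z • u := by
  simp only [eigenspace, Submodule.mem_comap, LinearPMap.mem_graph_iff]
  constructor
  · rintro ⟨y, hy, h⟩
    have hy' : (y : E) = u := hy
    subst hy'
    exact ⟨y.2, h⟩
  · rintro ⟨h, h'⟩
    exact ⟨⟨u, h⟩, rfl, h'⟩

/-- The point spectrum `σ_p(T)`, the set of all eigenvalues. -/
def pointSpectrum (T : E →ₗ.[ℂ] E) : Set ℂ :=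
  {z | ∃ u ∈ eigenspace T z, u ≠ 0}

/-- The spectrum `σ(T)`: the complement of the set of `z` for which `T - z : D(T) → E` is a
bijection with a bounded inverse `R`. -/
def opSpectrum (T : E →ₗ.[ℂ] E) : Set ℂ :=
  {z | ∃ R : E →L[ℂ] E,
    (∀ f : E, ∃ h : R f ∈ T.domain, T ⟨R f, h⟩ - z • R f = f) ∧
    ∀ u : T.domain, R (T u - z • (u : E)) = u}ᶜ

end Operators

/-! ### Differential operators on `L²(ℝ)` -/

/-- The Hilbert space `L²(ℝ; ℂ)`. -/
abbrev L2 : Type := Lp ℂ 2 (volume : Measure ℝ)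

/-- `v ∈ L²` is the weak derivative of `u ∈ L²`. -/
def IsWeakDeriv (u v : L2) : Prop :=
  ∀ η : ℝ → ℝ, ContDiff ℝ ∞ η → HasCompactSupport η →
    ∫ x, deriv η x • u x = -∫ x, η x • v x

theorem integrable_test_smul (u : L2) {η : ℝ → ℝ} (hη : Continuous η)
    (hs : HasCompactSupport η) : Integrable (fun x => η x • u x) := by
  have hu : LocallyIntegrable (u : ℝ → ℂ) := (Lp.memLp u).locallyIntegrable (by norm_num)
  exact hu.integrable_smul_left_of_hasCompactSupport hη hs

/-- The graph of the weak derivative. -/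
def weakDerivGraph : Submodule ℂ (L2 × L2) where
  carrier := {p | IsWeakDeriv p.1 p.2}
  zero_mem' := by
    intro η _ _
    have h0 : ((0 : L2) : ℝ → ℂ) =ᵐ[volume] 0 := Lp.coeFn_zero ..
    have h1 : ∫ x, deriv η x • ((0 : L2) : ℝ → ℂ) x = 0 := by
      rw [integral_eq_zero_of_ae]
      filter_upwards [h0] with x hx
      simp only [hx, Pi.zero_apply, smul_zero]
    have h2 : ∫ x, η x • ((0 : L2) : ℝ → ℂ) x = 0 := by
      rw [integral_eq_zero_of_ae]
      filter_upwards [h0] with x hx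
      simp only [hx, Pi.zero_apply, smul_zero]
    simp only [Prod.fst_zero, Prod.snd_zero]
    rw [h1, h2, neg_zero]
  add_mem' := by
    rintro ⟨u, v⟩ ⟨u', v'⟩ h h' η hη hs
    have hd : Continuous (deriv η) := hη.continuous_deriv (by simp)
    have e1 : ∫ x, deriv η x • ((u + u' : L2) : ℝ → ℂ) x
        = (∫ x, deriv η x • u x) + ∫ x, deriv η x • u' x := by
      rw [← integral_add (integrable_test_smul u hd hs.deriv) (integrable_test_smul u' hd hs.deriv)]
      apply integral_congr_ae
      filter_upwards [Lp.coeFn_add u u'] with x hx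
      rw [hx, Pi.add_apply, smul_add]
    have e2 : ∫ x, η x • ((v + v' : L2) : ℝ → ℂ) x
        = (∫ x, η x • v x) + ∫ x, η x • v' x := by
      rw [← integral_add (integrable_test_smul v hη.continuous hs)
        (integrable_test_smul v' hη.continuous hs)]
      apply integral_congr_ae
      filter_upwards [Lp.coeFn_add v v'] with x hx
      rw [hx, Pi.add_apply, smul_add]
    change ∫ x, deriv η x • ((u + u' : L2) : ℝ → ℂ) x = -∫ x, η x • ((v + v' : L2) : ℝ → ℂ) x
    rw [e1, e2, h η hη hs, h' η hη hs, neg_add]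
  smul_mem' := by
    rintro c ⟨u, v⟩ h η hη hs
    have e1 : ∫ x, deriv η x • ((c • u : L2) : ℝ → ℂ) x = c • ∫ x, deriv η x • u x := by
      rw [← integral_smul]
      apply integral_congr_ae
      filter_upwards [Lp.coeFn_smul c u] with x hx
      rw [hx, Pi.smul_apply, smul_comm]
    have e2 : ∫ x, η x • ((c • v : L2) : ℝ → ℂ) x = c • ∫ x, η x • v x := by
      rw [← integral_smul]
      apply integral_congr_ae
      filter_upwards [Lp.coeFn_smul c v] with x hx
      rw [hx, Pi.smul_apply, smul_comm]
    change ∫ x, deriv η x • ((c • u : L2) : ℝ → ℂ) x = -∫ x, η x • ((c • v : L2) : ℝ → ℂ) x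
    rw [e1, e2, h η hη hs, smul_neg]

/-- The derivative `∂ₓ` as an unbounded operator on `L²(ℝ)`, with domain `H¹(ℝ)`: the space of
all `u ∈ L²` that have a weak derivative in `L²`. -/
def weakDeriv : L2 →ₗ.[ℂ] L2 := weakDerivGraph.toLinearPMap

/-- The weak derivative is unique, so `weakDeriv` has exactly the prescribed graph. -/
theorem mem_weakDeriv_graph_iff (u v : L2) : (u, v) ∈ weakDeriv.graph ↔ IsWeakDeriv u v := by
  rw [weakDeriv, Submodule.toLinearPMap_graph_eq]
  · rfl
  · rintro ⟨u, v⟩ h h0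
    have hu : u = 0 := h0
    subst hu
    have hv : ∀ᵐ x, (v : ℝ → ℂ) x = 0 := by
      apply ae_eq_zero_of_integral_contDiff_smul_eq_zero
        ((Lp.memLp v).locallyIntegrable (by norm_num))
      intro η hη hs
      have h1 := h η hη hs
      have h2 : ∫ x, deriv η x • ((0 : L2) : ℝ → ℂ) x = 0 := by
        rw [integral_eq_zero_of_ae]
        filter_upwards [Lp.coeFn_zero (E := ℂ) (p := 2) (μ := (volume : Measure ℝ))] with x hx
        simp only [hx, Pi.zero_apply, smul_zero]
      change ∫ x, deriv η x • ((0 : L2) : ℝ → ℂ) x = -∫ x, η x • (v : ℝ → ℂ) x at h1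
      rw [h2] at h1
      exact neg_eq_zero.mp h1.symm
    exact (Lp.eq_zero_iff_ae_eq_zero).2 hv

/-- The Sobolev space `H²(ℝ)`. -/
def H2 : Submodule ℂ L2 := (opComp weakDeriv weakDeriv).domain

/-- The maximal domain `{u ∈ L² : f u ∈ L²}` of the multiplication by `f`. -/
def mulDomain (f : ℝ → ℝ) : Submodule ℂ L2 where
  carrier := {u | MemLp (fun x => (f x : ℂ) * u x) 2 volume}
  zero_mem' := by
    refine (memLp_congr_ae ?_).1 (MemLp.zero (ε := ℂ))
    filter_upwards [Lp.coeFn_zero (E := ℂ) (p := 2) (μ := (volume : Measure ℝ))] with x hx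
    simp only [hx, Pi.zero_apply, mul_zero]
  add_mem' := by
    intro u v hu hv
    refine (memLp_congr_ae ?_).1 (MemLp.add hu hv)
    filter_upwards [Lp.coeFn_add u v] with x hx
    rw [hx, Pi.add_apply, Pi.add_apply, mul_add]
  smul_mem' := by
    intro c u hu
    refine (memLp_congr_ae ?_).1 (MemLp.const_smul hu c)
    filter_upwards [Lp.coeFn_smul c u] with x hx
    rw [hx, Pi.smul_apply, Pi.smul_apply, smul_eq_mul, smul_eq_mul, mul_left_comm]

theorem memLp_of_mem_mulDomain {f : ℝ → ℝ} {u : L2} (hu : u ∈ mulDomain f) :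
    MemLp (fun x => (f x : ℂ) * u x) 2 volume := hu

/-- Multiplication by the function `f`, with its maximal domain. -/
def mulOp (f : ℝ → ℝ) : L2 →ₗ.[ℂ] L2 where
  domain := mulDomain f
  toFun :=
    { toFun := fun u => MemLp.toLp (fun x => (f x : ℂ) * (u : L2) x) (memLp_of_mem_mulDomain u.2)
      map_add' := by
        intro u v
        rw [← MemLp.toLp_add]
        apply MemLp.toLp_congr
        filter_upwards [Lp.coeFn_add (u : L2) (v : L2)] with x hx
        rw [Submodule.coe_add, hx, Pi.add_apply, Pi.add_apply, mul_add]
      map_smul' := by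
        intro c u
        rw [RingHom.id_apply, ← MemLp.toLp_const_smul]
        apply MemLp.toLp_congr
        filter_upwards [Lp.coeFn_smul c (u : L2)] with x hx
        rw [Submodule.coe_smul, hx, Pi.smul_apply, Pi.smul_apply, smul_eq_mul, smul_eq_mul,
          mul_left_comm] }

/-- A bounded measurable function multiplies all of `L²` into `L²`. -/
theorem mulOp_domain_eq_top {f : ℝ → ℝ} (hf : Measurable f) {C : ℝ} (hC : ∀ x, |f x| ≤ C) :
    (mulOp f).domain = ⊤ := by
  rw [eq_top_iff]
  intro u _
  change MemLp (fun x => (f x : ℂ) * u x) 2 volume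
  refine MemLp.of_le_mul (c := C) (Lp.memLp u)
    ((Complex.measurable_ofReal.comp hf).aestronglyMeasurable.mul (Lp.aestronglyMeasurable u)) ?_
  filter_upwards with x
  rw [norm_mul, Complex.norm_real, Real.norm_eq_abs]
  exact mul_le_mul_of_nonneg_right (hC x) (norm_nonneg _)

/-- The Schrödinger operator `-∂ₓ² + W` on `L²(ℝ)`, with domain `{u ∈ H²(ℝ) : W u ∈ L²}`
(which is `H²(ℝ)` when `W` is bounded). -/
def schrodinger (W : ℝ → ℝ) : L2 →ₗ.[ℂ] L2 :=
  -(opComp weakDeriv weakDeriv) + mulOp W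

/-! ### The kink operator -/

/-- The soliton `Q(x) = (3/2) sech²(x/2)`. -/
def Q (x : ℝ) : ℝ := 3 / 2 * (1 / Real.cosh (x / 2)) ^ 2

/-- `α(x) = (sinh x + x) / 3`. -/
def alpha (x : ℝ) : ℝ := 1 / 3 * (Real.sinh x + x)

theorem alpha_strictMono : StrictMono alpha := by
  intro x y h
  have := Real.sinh_strictMono h
  unfold alpha
  linarith

theorem alpha_surjective : Function.Surjective alpha := by
  have hc : Continuous alpha := by
    unfold alpha
    fun_prop
  refine hc.surjective ?_ ?_
  · have h : Filter.Tendsto (fun x : ℝ => Real.sinh x + x) Filter.atTop Filter.atTop :=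
      Real.sinhOrderIso.tendsto_atTop.atTop_add_atTop Filter.tendsto_id
    exact h.const_mul_atTop (by norm_num)
  · have h : Filter.Tendsto (fun x : ℝ => Real.sinh x + x) Filter.atBot Filter.atBot :=
      Real.sinhOrderIso.tendsto_atBot.atBot_add_atBot Filter.tendsto_id
    exact h.const_mul_atBot (by norm_num)

/-- `α` as an increasing bijection of the real line. -/
def alphaIso : ℝ ≃o ℝ := alpha_strictMono.orderIsoOfSurjective alpha alpha_surjective

/-- `Q̃ = Q ∘ α⁻¹`. -/
def Qt (x : ℝ) : ℝ := Q (alphaIso.symm x)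

/-- The potential `V = 2 Q̃² (1 - Q̃)`. -/
def V (x : ℝ) : ℝ := 2 * Qt x ^ 2 * (1 - Qt x)

/-- The linearized operator `L = -∂ₓ² + 2 Q̃² (1 - Q̃)`. -/
def L : L2 →ₗ.[ℂ] L2 := schrodinger V

theorem L_domain : L.domain = H2 := by
  have hQc : Continuous Q := by
    unfold Q
    have : ∀ x : ℝ, Real.cosh (x / 2) ≠ 0 := fun x => (Real.cosh_pos _).ne'
    fun_prop (disch := simp_all)
  have hc : Continuous Qt := hQc.comp alphaIso.symm.continuous
  have hV : Continuous V := by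
    unfold V
    fun_prop
  have hb : ∀ x, 0 ≤ Qt x ∧ Qt x ≤ 3 / 2 := by
    intro x
    unfold Qt Q
    have h1 := Real.one_le_cosh (alphaIso.symm x / 2)
    have h2 : 1 / Real.cosh (alphaIso.symm x / 2) ≤ 1 := by
      rw [div_le_one (by linarith)]
      exact h1
    have h3 : 0 ≤ 1 / Real.cosh (alphaIso.symm x / 2) := by positivity
    constructor
    · positivity
    · nlinarith
  have hVb : ∀ x, |V x| ≤ 9 / 2 := by
    intro x
    obtain ⟨h1, h2⟩ := hb x
    have h3 : |1 - Qt x| ≤ 1 := abs_le.2 ⟨by linarith, by linarith⟩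
    unfold V
    rw [abs_mul, abs_of_nonneg (by positivity : (0 : ℝ) ≤ 2 * Qt x ^ 2)]
    nlinarith [sq_nonneg (Qt x), abs_nonneg (1 - Qt x)]
  change (opComp weakDeriv weakDeriv).domain ⊓ (mulOp V).domain = H2
  rw [mulOp_domain_eq_top hV.measurable hVb, inf_top_eq, H2]

/-! ### The supersymmetric partner -/

/-- The logarithmic derivative `φ' / φ`. -/
def logDerivative (φ : ℝ → ℝ) (x : ℝ) : ℝ := deriv φ x / φ x

/-- `U = φ · ∂ₓ · φ⁻¹ = ∂ₓ - φ' / φ`. -/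
def U (φ : ℝ → ℝ) : L2 →ₗ.[ℂ] L2 := weakDeriv - mulOp (logDerivative φ)

/-- `U* = -φ⁻¹ · ∂ₓ · φ = -∂ₓ - φ' / φ`. -/
def Ustar (φ : ℝ → ℝ) : L2 →ₗ.[ℂ] L2 := -weakDeriv - mulOp (logDerivative φ)

/-- The transformed potential `V₀ = 2 (φ' / φ)² - 2 μ² - V`. -/
def V0 (μ : ℝ) (φ : ℝ → ℝ) (x : ℝ) : ℝ := 2 * (deriv φ x / φ x) ^ 2 - 2 * μ ^ 2 - V x

/-- The partner operator `L₀ = -∂ₓ² + V₀`. -/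
def L0 (μ : ℝ) (φ : ℝ → ℝ) : L2 →ₗ.[ℂ] L2 := schrodinger (V0 μ φ)

end KinkSpectrum

end

open KinkSpectrum

/-! The proof is a Darboux (supersymmetric) factorization around a ground state found by shooting.
If φ > 0 solves φ'' = (V + μ²)φ, then h = φ'/φ satisfies the Riccati equation h' = V + μ² - h².
Expanding the products U*U and UU* turns it into L = U*U - μ² and L₀ = UU* - μ²
(`schrodinger_eq_Ustar_U`, `schrodinger_eq_U_Ustar`); the domains agree because h is smooth and h,
h' are bounded.

Away from -μ² the two products have the same eigenvalues, via u ↦ Uu and v ↦ U*v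
(`pointSpectrum_opComp_swap`). So everything rests on V₀ ≥ 0: then all eigenvalues of L₀ are
positive, hence L has no negative eigenvalue besides -μ², and this one is simple because ker U is
spanned by φ. The inclusion σ(L₀) ⊆ [0,∞) comes from von Neumann's construction of (1 + UU*)⁻¹ as a
bounded positive operator (`opSpectrum_subset_nonneg`).

The ground state is obtained by shooting in l for the even solution of φ'' = (V + l)φ, φ(0) = 1. The
value μ² is the supremum of those l for which the solution becomes negative. A trial function shows
μ² ≥ 1/2 (`exists_neg_of_half`); at the supremum φ is positive and nonincreasing on [0,∞)
(`exists_decreasing_evenSolution`), and it decays (`exists_decay`).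

For V₀ ≥ 0 (`partner_nonneg`), consider Z = φ'² - (μ² + V/2)φ² = φ²V₀/2, for which Z' = φ(Vφ' -
V'φ/2). On the half line Z is nonincreasing and bounded below by a quantity tending to 0, hence Z ≥
0. In the coordinate s = tanh(α⁻¹(y)/2) both V and ds/dy are polynomials in s, so the sign of Z'
becomes a polynomial inequality, given h ≥ -(15/4)s where s² ≤ 1/3 and h ≤ -1/2 where s² ≥ 1/3. -/

namespace KinkSpectrum

/-! ### Graphs of sums, differences and shifts of unbounded operators -/

section GraphCalculus

variable {E : Type*} [NormedAddCommGroup E] [InnerProductSpace ℂ E]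

theorem mem_add_graph_iff (A B : E →ₗ.[ℂ] E) (u w : E) :
    (u, w) ∈ (A + B).graph ↔ ∃ a b, (u, a) ∈ A.graph ∧ (u, b) ∈ B.graph ∧ w = a + b := by
  simp only [LinearPMap.mem_graph_iff]
  constructor
  · rintro ⟨y, rfl, rfl⟩
    exact ⟨_, _, ⟨⟨y, y.2.1⟩, rfl, rfl⟩, ⟨⟨y, y.2.2⟩, rfl, rfl⟩, rfl⟩
  · rintro ⟨a, b, ⟨y, rfl, rfl⟩, ⟨z, hz, rfl⟩, rfl⟩
    obtain ⟨z, hz'⟩ := z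
    obtain rfl : z = y := hz
    exact ⟨⟨y, y.2, hz'⟩, rfl, rfl⟩

theorem mem_neg_graph_iff (A : E →ₗ.[ℂ] E) (u w : E) :
    (u, w) ∈ (-A).graph ↔ (u, -w) ∈ A.graph := by
  simp only [LinearPMap.mem_graph_iff]
  constructor
  · rintro ⟨y, rfl, rfl⟩
    exact ⟨y, rfl, by simp⟩
  · rintro ⟨y, rfl, h⟩
    exact ⟨y, rfl, by simp [h]⟩

theorem mem_sub_graph_iff (A B : E →ₗ.[ℂ] E) (u w : E) :
    (u, w) ∈ (A - B).graph ↔ ∃ a b, (u, a) ∈ A.graph ∧ (u, b) ∈ B.graph ∧ w = a - b := by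
  simp only [LinearPMap.mem_graph_iff]
  constructor
  · rintro ⟨y, rfl, rfl⟩
    exact ⟨_, _, ⟨⟨y, y.2.1⟩, rfl, rfl⟩, ⟨⟨y, y.2.2⟩, rfl, rfl⟩, rfl⟩
  · rintro ⟨a, b, ⟨y, rfl, rfl⟩, ⟨z, hz, rfl⟩, rfl⟩
    obtain ⟨z, hz'⟩ := z
    obtain rfl : z = y := hz
    exact ⟨⟨y, y.2, hz'⟩, rfl, rfl⟩

theorem mem_opSubConst_graph_iff (A : E →ₗ.[ℂ] E) (c : ℂ) (u w : E) :
    (u, w) ∈ (opSubConst A c).graph ↔ (u, w + c • u) ∈ A.graph := by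
  rw [opSubConst, mem_sub_graph_iff]
  constructor
  · rintro ⟨a, b, ha, hb, rfl⟩
    obtain ⟨y, hy, rfl⟩ := (LinearPMap.mem_graph_iff _).1 hb
    obtain rfl : (y : E) = u := hy
    have : ((c • (LinearMap.id : E →ₗ[ℂ] E)).toPMap ⊤) y = c • (y : E) := rfl
    simpa [this] using ha
  · intro h
    exact ⟨_, c • u, h, (LinearPMap.mem_graph_iff _).2 ⟨⟨u, trivial⟩, rfl, rfl⟩, by simp⟩

theorem mem_eigenspace_iff_graph (A : E →ₗ.[ℂ] E) (z : ℂ) (u : E) :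
    u ∈ eigenspace A z ↔ (u, z • u) ∈ A.graph := Iff.rfl

end GraphCalculus

/-! ### Algebra of the products AB and BA -/

section Factorization

variable {E : Type*} [NormedAddCommGroup E] [InnerProductSpace ℂ E]

/-- The eigenvalue problem for `A B - c` transports to `B A - c` through `B`. -/
theorem pointSpectrum_opComp_swap {A B : E →ₗ.[ℂ] E} {c z : ℂ} (hz : z ≠ -c)
    (h : z ∈ pointSpectrum (opSubConst (opComp A B) c)) :
    z ∈ pointSpectrum (opSubConst (opComp B A) c) := by
  obtain ⟨u, hu, hu0⟩ := h
  rw [mem_eigenspace_iff_graph, mem_opSubConst_graph_iff, ← add_smul, mem_opComp_graph_iff] at hu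
  obtain ⟨v, huv, hv⟩ := hu
  have hzc : z + c ≠ 0 := fun h => hz (eq_neg_of_add_eq_zero_left h)
  refine ⟨v, ?_, ?_⟩
  · rw [mem_eigenspace_iff_graph, mem_opSubConst_graph_iff, ← add_smul, mem_opComp_graph_iff]
    exact ⟨_, hv, B.graph.smul_mem (z + c) huv⟩
  -- If Bu = 0 then (z + c)u = A0 = 0, impossible for z ≠ -c and u ≠ 0.
  · rintro rfl
    have := LinearPMap.graph_fst_eq_zero_snd A hv rfl
    exact (smul_ne_zero hzc hu0) this

/-- `⟨A B u, u⟩ = ‖B u‖²` when `B = A*`. -/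
theorem inner_eq_of_mem_opComp_graph {A B : E →ₗ.[ℂ] E} (hB : B.graph = A.graph.adjoint)
    {u w : E} (h : (u, w) ∈ (opComp A B).graph) :
    ∃ v, (u, v) ∈ B.graph ∧ (v, w) ∈ A.graph ∧ inner ℂ w u = inner ℂ v v := by
  obtain ⟨v, huv, hv⟩ := (mem_opComp_graph_iff _ _ _ _).1 h
  refine ⟨v, huv, hv, ?_⟩
  rw [hB, Submodule.mem_adjoint_iff] at huv
  exact sub_eq_zero.1 (huv _ _ hv)

end Factorization

/-! ### Von Neumann's theorem and the spectrum of AB - c -/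

section Resolvent

variable {E : Type*} [NormedAddCommGroup E] [InnerProductSpace ℂ E] [CompleteSpace E]

/-- Von Neumann: `1 + A B` is onto with bounded inverse when `B = A*` and `A = B*`. -/
theorem exists_inverse_one_add_opComp {A B : E →ₗ.[ℂ] E} (hB : B.graph = A.graph.adjoint)
    (hA : A.graph = B.graph.adjoint) :
    ∃ R : E →L[ℂ] E, ∀ f, (R f, f - R f) ∈ (opComp A B).graph := by
  set e := WithLp.linearEquiv 2 ℂ (E × E)
  let G : Submodule ℂ (WithLp 2 (E × E)) := B.graph.map e.symm.toLinearMap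
  have hG : ∀ p : WithLp 2 (E × E), p ∈ G ↔ (p.fst, p.snd) ∈ B.graph := by
    intro p
    constructor
    · rintro ⟨q, hq, rfl⟩
      exact hq
    · intro h
      exact ⟨_, h, rfl⟩
  -- The graph of B is an adjoint, so it is cut out by continuous linear conditions; closedness
  -- makes the orthogonal projection onto it available.
  have hcl : IsClosed (G : Set (WithLp 2 (E × E))) := by
    have h1 : (G : Set (WithLp 2 (E × E))) = ⋂ ab ∈ A.graph,
        {p | inner ℂ ab.2 p.fst - inner ℂ ab.1 p.snd = 0} := by
      ext p
      rw [SetLike.mem_coe, hG, hB, Submodule.mem_adjoint_iff]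
      simp only [Set.mem_iInter, Prod.forall]
      rfl
    rw [h1]
    refine isClosed_biInter fun ab _ => isClosed_eq ?_ continuous_const
    have c1 : Continuous fun p : WithLp 2 (E × E) => p.fst :=
      continuous_fst.comp (WithLp.prod_continuous_ofLp 2 E E)
    have c2 : Continuous fun p : WithLp 2 (E × E) => p.snd :=
      continuous_snd.comp (WithLp.prod_continuous_ofLp 2 E E)
    fun_prop
  have : CompleteSpace G := hcl.completeSpace_coe
  let ι : E →L[ℂ] WithLp 2 (E × E) :=
    (WithLp.prodContinuousLinearEquiv 2 ℂ E E).symm.toContinuousLinearMap.comp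
      (ContinuousLinearMap.inl ℂ E E)
  let π : WithLp 2 (E × E) →L[ℂ] E :=
    (ContinuousLinearMap.fst ℂ E E).comp
      (WithLp.prodContinuousLinearEquiv 2 ℂ E E).toContinuousLinearMap
  refine ⟨π.comp (G.starProjection.comp ι), fun f => ?_⟩
  -- Project (f, 0) onto the graph of B, with result (u, Bu). The remainder (f - u, -Bu) is
  -- orthogonal to the graph, which says exactly that A(Bu) = f - u.
  set p := G.starProjection (ι f) with hp
  have hpG : p ∈ G := Submodule.starProjection_apply_mem _ _
  have hR : (π.comp (G.starProjection.comp ι)) f = p.fst := rfl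
  rw [hR]
  refine (mem_opComp_graph_iff _ _ _ _).2 ⟨p.snd, (hG p).1 hpG, ?_⟩
  rw [hA, Submodule.mem_adjoint_iff]
  intro a b hab
  have h2 := Submodule.starProjection_inner_eq_zero (K := G) (ι f) (WithLp.toLp 2 (a, b))
    ((hG _).2 hab)
  rw [← hp] at h2
  have h3 : inner ℂ (ι f - p) (WithLp.toLp 2 (a, b)) =
      inner ℂ (f - p.fst) a + inner ℂ (0 - p.snd) b := rfl
  rw [h3] at h2
  have h4 := congrArg (starRingEnd ℂ) h2
  simp only [map_add, inner_conj_symm, map_zero, zero_sub, inner_neg_right] at h4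
  linear_combination -h4

theorem spectrum_subset_of_isPositive {R : E →L[ℂ] E} (hR : R.IsPositive) {C : ℝ}
    (hC : ‖R‖ ≤ C) {ζ : ℂ} (hζ : ζ ∈ spectrum ℂ R) : ∃ r : ℝ, 0 ≤ r ∧ r ≤ C ∧ ζ = r := by
  have hsa : IsSelfAdjoint R := hR.isSelfAdjoint
  have h1 := hsa.mem_spectrum_eq_re hζ
  have hnn : 0 ≤ R := (ContinuousLinearMap.nonneg_iff_isPositive R).2 hR
  have hre : ζ.re ∈ spectrum ℝ R := by
    rw [h1] at hζ
    exact (spectrum.algebraMap_mem_iff ℂ).1 hζ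
  refine ⟨ζ.re, spectrum_nonneg_of_nonneg hnn hre, ?_, h1⟩
  have : Nontrivial E := by
    by_contra hn
    rw [not_nontrivial_iff_subsingleton] at hn
    have : Subsingleton (E →L[ℂ] E) := inferInstance
    rw [spectrum.of_subsingleton] at hζ
    exact hζ
  exact (Complex.re_le_norm ζ).trans ((spectrum.norm_le_norm_of_mem hζ).trans hC)

/-- Let S = AB - c and R = (1 + AB)⁻¹ = (S + 1 + c)⁻¹. Since S ≥ 0, R is positive with ‖R‖ ≤ 1/(1 +
c). Formally S - z = R⁻¹(1 - ζR) with ζ = z + 1 + c, so the resolvent is R(1 - ζR)⁻¹. It fails to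
exist only if ζ⁻¹ lies in the spectrum of R, which forces ζ ≥ 1 + c, that is z ≥ 0. -/
theorem opSpectrum_subset_nonneg {A B : E →ₗ.[ℂ] E} (hB : B.graph = A.graph.adjoint)
    (hA : A.graph = B.graph.adjoint) {c : ℝ} (hc : 0 ≤ c)
    (hpos : ∀ u w, (u, w) ∈ (opSubConst (opComp A B) c).graph → 0 ≤ (inner ℂ w u : ℂ).re) :
    ∀ z ∈ opSpectrum (opSubConst (opComp A B) c), ∃ r : ℝ, 0 ≤ r ∧ z = r := by
  obtain ⟨R, hR⟩ := exists_inverse_one_add_opComp hB hA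
  set S := opSubConst (opComp A B) (c : ℂ) with hS
  have hSR : ∀ f, (R f, f - ((1 + c : ℝ) : ℂ) • R f) ∈ S.graph := by
    intro f
    rw [hS, mem_opSubConst_graph_iff]
    convert! hR f using 2
    push_cast
    module
  -- The difference d of the two sides satisfies Sd = -(1 + c)d, so positivity of the form gives d =
  -- 0.
  have hinj : ∀ u w, (u, w) ∈ S.graph → R (w + ((1 + c : ℝ) : ℂ) • u) = u := by
    intro u w huw
    have h1 := S.graph.sub_mem (hSR (w + ((1 + c : ℝ) : ℂ) • u)) huw
    set d := R (w + ((1 + c : ℝ) : ℂ) • u) - u with hd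
    have h2 : (d, -((1 + c : ℝ) : ℂ) • d) ∈ S.graph := by
      convert! h1 using 1
      rw [Prod.mk_sub_mk, hd]
      congr 1
      module
    have h3 := hpos _ _ h2
    rw [inner_smul_left, inner_self_eq_norm_sq_to_K] at h3
    have h4 : (starRingEnd ℂ (-((1 + c : ℝ) : ℂ)) * ((‖d‖ : ℂ)) ^ 2).re = -(1 + c) * ‖d‖ ^ 2 := by
      rw [map_neg, Complex.conj_ofReal, ← Complex.ofReal_pow, ← Complex.ofReal_neg,
        ← Complex.ofReal_mul, Complex.ofReal_re]
    have h5 : 0 ≤ -(1 + c) * ‖d‖ ^ 2 := by rw [← h4]; exact h3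
    have h6 : ‖d‖ = 0 := by
      by_contra hne
      have : 0 < ‖d‖ ^ 2 := by positivity
      nlinarith
    exact sub_eq_zero.1 (norm_eq_zero.1 h6)
  -- ⟨f, Rf⟩ = ‖B R f‖² + ‖R f‖², from f = (1 + AB)Rf.
  have hRpos : R.IsPositive := by
    rw [ContinuousLinearMap.isPositive_iff_complex]
    intro f
    obtain ⟨v, -, -, h⟩ := inner_eq_of_mem_opComp_graph hB (hR f)
    have h1 : (inner ℂ f (R f) : ℂ) = inner ℂ v v + inner ℂ (R f) (R f) := by
      rw [← h, ← inner_add_left, sub_add_cancel]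
    have h2 : (inner ℂ (R f) f : ℂ) = ((‖v‖ ^ 2 + ‖R f‖ ^ 2 : ℝ) : ℂ) := by
      rw [← inner_conj_symm, h1, inner_self_eq_norm_sq_to_K, inner_self_eq_norm_sq_to_K]
      push_cast
      simp
    rw [h2]
    refine ⟨rfl, ?_⟩
    simp only [RCLike.re_eq_complex_re, Complex.ofReal_re]
    positivity
  -- Positivity of S at Rf gives (1 + c)‖Rf‖² ≤ Re ⟨f, Rf⟩ ≤ ‖f‖‖Rf‖.
  have hRn : ‖R‖ ≤ 1 / (1 + c) := by
    refine R.opNorm_le_bound (by positivity) fun f => ?_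
    have h1 := hpos _ _ (hSR f)
    rw [inner_sub_left, inner_smul_left, Complex.conj_ofReal, inner_self_eq_norm_sq_to_K] at h1
    have h2 : (((1 + c : ℝ) : ℂ) * ((‖R f‖ : ℂ)) ^ 2).re = (1 + c) * ‖R f‖ ^ 2 := by
      rw [← Complex.ofReal_pow, ← Complex.ofReal_mul, Complex.ofReal_re]
    have h3 : (1 + c) * ‖R f‖ ^ 2 ≤ (inner ℂ f (R f) : ℂ).re := by
      rw [← h2]
      simpa using h1
    have h4 : (inner ℂ f (R f) : ℂ).re ≤ ‖f‖ * ‖R f‖ :=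
      (Complex.re_le_norm _).trans (norm_inner_le_norm _ _)
    rw [one_div_mul_eq_div, le_div_iff₀ (by positivity)]
    rcases (norm_nonneg (R f)).eq_or_lt with h0 | h0
    · rw [← h0]; simp
    · nlinarith
  intro z hz
  by_contra hcon
  apply hz
  set ζ : ℂ := z + ((1 + c : ℝ) : ℂ) with hζ
  have hunit : IsUnit (1 - ζ • R : E →L[ℂ] E) := by
    by_cases h0 : ζ = 0
    · rw [h0, zero_smul, sub_zero]
      exact isUnit_one
    · have h1 : ζ⁻¹ ∉ spectrum ℂ R := by
        intro hmem
        obtain ⟨r, hr0, hrC, hr⟩ := spectrum_subset_of_isPositive hRpos hRn hmem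
        have hr1 : r ≠ 0 := by
          rintro rfl
          simp [h0] at hr
        have hrp : 0 < r := lt_of_le_of_ne hr0 hr1.symm
        have h2 : ζ = ((r⁻¹ : ℝ) : ℂ) := by
          rw [Complex.ofReal_inv, ← hr, inv_inv]
        refine hcon ⟨r⁻¹ - (1 + c), ?_, ?_⟩
        · have : 1 + c ≤ r⁻¹ := by
            rw [le_inv_comm₀ (by positivity) hrp, ← one_div]
            exact hrC
          linarith
        · rw [Complex.ofReal_sub, ← h2, hζ, add_sub_cancel_right]
      have h2 := spectrum.notMem_iff.1 h1
      have h3 : (1 - ζ • R : E →L[ℂ] E) = ζ • (algebraMap ℂ (E →L[ℂ] E) ζ⁻¹ - R) := by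
        rw [Algebra.algebraMap_eq_smul_one, smul_sub, smul_inv_smul₀ h0]
      rw [h3]
      exact h2.smul (Units.mk0 ζ h0)
  obtain ⟨T, hT⟩ := hunit
  have hT1 : ∀ f, (T⁻¹ : (E →L[ℂ] E)ˣ).1 f - ζ • R ((T⁻¹ : (E →L[ℂ] E)ˣ).1 f) = f := by
    intro f
    have := congrArg (fun X : E →L[ℂ] E => X f) T.mul_inv
    rw [hT] at this
    exact this
  have hT2 : ∀ f, (T⁻¹ : (E →L[ℂ] E)ˣ).1 (f - ζ • R f) = f := by
    intro f
    have := congrArg (fun X : E →L[ℂ] E => X f) T.inv_mul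
    rw [hT] at this
    exact this
  refine ⟨R.comp (T⁻¹ : (E →L[ℂ] E)ˣ).1, fun f => ?_, fun u => ?_⟩
  · have h1 := hSR ((T⁻¹ : (E →L[ℂ] E)ˣ).1 f)
    refine ⟨LinearPMap.mem_domain_of_mem_graph h1, ?_⟩
    have h2 : S ⟨R ((T⁻¹ : (E →L[ℂ] E)ˣ).1 f), LinearPMap.mem_domain_of_mem_graph h1⟩ =
        (T⁻¹ : (E →L[ℂ] E)ˣ).1 f - ((1 + c : ℝ) : ℂ) • R ((T⁻¹ : (E →L[ℂ] E)ˣ).1 f) :=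
      ((LinearPMap.image_iff _).2 h1).symm
    change S ⟨R ((T⁻¹ : (E →L[ℂ] E)ˣ).1 f), _⟩ - z • R ((T⁻¹ : (E →L[ℂ] E)ˣ).1 f) = f
    rw [h2]
    conv_rhs => rw [← hT1 f, hζ]
    module
  · have h1 := hinj _ _ (LinearPMap.mem_graph S u)
    set g := S u + ((1 + c : ℝ) : ℂ) • (u : E) with hg
    have h2 : S u - z • (u : E) = g - ζ • R g := by
      rw [h1, hg, hζ]
      module
    change R ((T⁻¹ : (E →L[ℂ] E)ˣ).1 (S u - z • (u : E))) = u
    rw [h2, hT2, h1]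

end Resolvent

/-! ### Primitives of locally integrable functions; du Bois-Reymond -/

section Primitives

open Set Filter Topology intervalIntegral

theorem intervalIntegrable_of_locallyIntegrable {v : ℝ → ℂ} (hv : LocallyIntegrable v) (a b : ℝ) :
    IntervalIntegrable v volume a b :=
  intervalIntegrable_iff.2 <| (hv.integrableOn_isCompact isCompact_uIcc).mono_set uIoc_subset_uIcc

/-- Reduces to real integrands by splitting v into real and imaginary parts, multiplied by the
constants 1 and I. -/
theorem absolutelyContinuousOnInterval_primitive {v : ℝ → ℂ} (hv : LocallyIntegrable v)
    (c : ℂ) {a b : ℝ} :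
    AbsolutelyContinuousOnInterval (fun x => c + ∫ t in a..x, v t) a b := by
  have hi := intervalIntegrable_of_locallyIntegrable hv
  have hre : IntervalIntegrable (fun t => (v t).re) volume a b :=
    ⟨(hi a b).1.re, (hi a b).2.re⟩
  have him : IntervalIntegrable (fun t => (v t).im) volume a b :=
    ⟨(hi a b).1.im, (hi a b).2.im⟩
  have hcst : ∀ d : ℂ, AbsolutelyContinuousOnInterval (fun _ : ℝ => d) a b := fun d =>
    ((LipschitzWith.const d).lipschitzOnWith (K := 0)).absolutelyContinuousOnInterval
  have h1 := (hre.absolutelyContinuousOnInterval_intervalIntegral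
    (c := a) left_mem_uIcc).fun_smul (hcst 1)
  have h2 := (him.absolutelyContinuousOnInterval_intervalIntegral
    (c := a) left_mem_uIcc).fun_smul (hcst Complex.I)
  have h3 := (hcst c).fun_add (h1.fun_add h2)
  convert! h3 using 2 with x
  congr 1
  have hx := hi a x
  have e : ∀ t, v t = ((v t).re : ℂ) + ((v t).im : ℂ) * Complex.I := fun t =>
    (Complex.re_add_im _).symm
  have hre' : IntervalIntegrable (fun t => ((v t).re : ℂ)) volume a x :=
    ⟨hx.1.re.ofReal, hx.2.re.ofReal⟩
  have him' : IntervalIntegrable (fun t => ((v t).im : ℂ)) volume a x :=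
    ⟨hx.1.im.ofReal, hx.2.im.ofReal⟩
  calc ∫ t in a..x, v t = ∫ t in a..x, ((v t).re : ℂ) + ((v t).im : ℂ) * Complex.I :=
        integral_congr fun t _ => e t
    _ = _ := by
      rw [intervalIntegral.integral_add hre' (him'.mul_const _), intervalIntegral.integral_mul_const,
        intervalIntegral.integral_ofReal, intervalIntegral.integral_ofReal]
      simp

/-- Integration by parts for two primitives of locally integrable functions. -/
theorem integral_mul_primitive_add {F G v w : ℝ → ℂ} (hv : LocallyIntegrable v)
    (hw : LocallyIntegrable w) (hF : ∀ a b, F b = F a + ∫ t in a..b, v t)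
    (hG : ∀ a b, G b = G a + ∫ t in a..b, w t) (a b : ℝ) :
    ∫ x in a..b, (v x * G x + F x * w x) = F b * G b - F a * G a := by
  have hFc : Continuous F := by
    have : F = fun x => F 0 + ∫ t in (0:ℝ)..x, v t := funext fun x => hF 0 x
    rw [this]
    exact continuous_const.add
      (intervalIntegral.continuous_primitive (intervalIntegrable_of_locallyIntegrable hv) 0)
  have hGc : Continuous G := by
    have : G = fun x => G 0 + ∫ t in (0:ℝ)..x, w t := funext fun x => hG 0 x
    rw [this]
    exact continuous_const.add
      (intervalIntegral.continuous_primitive (intervalIntegrable_of_locallyIntegrable hw) 0)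
  have hp : LocallyIntegrable fun x => v x * G x + F x * w x := by
    refine LocallyIntegrable.add ?_ ?_
    · have := hv.continuous_smul hGc
      simpa [mul_comm] using this
    · simpa using hw.continuous_smul hFc
  have hFac : AbsolutelyContinuousOnInterval F a b := by
    have : F = fun x => F a + ∫ t in a..x, v t := funext fun x => hF a x
    rw [this]
    exact absolutelyContinuousOnInterval_primitive hv _
  have hGac : AbsolutelyContinuousOnInterval G a b := by
    have : G = fun x => G a + ∫ t in a..x, w t := funext fun x => hG a x
    rw [this]
    exact absolutelyContinuousOnInterval_primitive hw _
  -- F and G are differentiable only almost everywhere, so the argument goes through absolute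
  -- continuity: FG minus the candidate primitive has zero derivative a.e., hence is constant.
  have hac := (hFac.fun_smul hGac).fun_sub
    (absolutelyContinuousOnInterval_primitive hp (F a * G a) (a := a) (b := b))
  have hd : ∀ᵐ x, x ∈ uIcc a b → HasDerivAt
      (fun x => F x • G x - (F a * G a + ∫ t in a..x, (v t * G t + F t * w t))) 0 x := by
    filter_upwards [LocallyIntegrable.ae_hasDerivAt_integral hv,
      LocallyIntegrable.ae_hasDerivAt_integral hw, LocallyIntegrable.ae_hasDerivAt_integral hp] with x h1 h2 h3 _
    have d1 : HasDerivAt F (v x) x := by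
      have : F = fun x => F a + ∫ t in a..x, v t := funext fun x => hF a x
      rw [this]
      exact (h1 a).const_add _
    have d2 : HasDerivAt G (w x) x := by
      have : G = fun x => G a + ∫ t in a..x, w t := funext fun x => hG a x
      rw [this]
      exact (h2 a).const_add _
    have := (d1.mul d2).sub ((h3 a).const_add (F a * G a))
    rw [sub_self] at this
    exact this
  obtain ⟨C, hC⟩ := hac.const_of_ae_hasDerivAt_zero hd
  have e1 := hC a left_mem_uIcc
  have e2 := hC b right_mem_uIcc
  simp only [smul_eq_mul, integral_same, add_zero, sub_self] at e1 e2
  linear_combination e1 - e2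

theorem eq_add_integral_deriv {η : ℝ → ℝ} (hη : ContDiff ℝ 1 η) (a b : ℝ) :
    (η b : ℂ) = η a + ∫ t in a..b, ((deriv η t : ℝ) : ℂ) := by
  rw [intervalIntegral.integral_ofReal, integral_deriv_eq_sub]
  · push_cast; ring
  · exact fun x _ => (hη.differentiable (by simp)).differentiableAt
  · exact (hη.continuous_deriv (by simp)).intervalIntegrable _ _

theorem exists_Icc_of_hasCompactSupport {η : ℝ → ℝ} (hs : HasCompactSupport η) :
    ∃ a b : ℝ, a < b ∧ ∀ x, x ∉ Ioo a b → η x = 0 := by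
  obtain ⟨R, hR⟩ := hs.isCompact.isBounded.subset_ball (0 : ℝ)
  refine ⟨-max R 1, max R 1, ?_, fun x hx => ?_⟩
  · have := le_max_right R 1
    linarith
  · by_contra hne
    have h1 := hR (subset_tsupport _ hne)
    rw [Real.ball_eq_Ioo] at h1
    have := le_max_left R 1
    exact hx ⟨by linarith [h1.1], by linarith [h1.2]⟩

theorem integral_deriv_smul_primitive {F v : ℝ → ℂ} (hv : LocallyIntegrable v)
    (hF : ∀ a b, F b = F a + ∫ t in a..b, v t) {η : ℝ → ℝ} (hη : ContDiff ℝ 1 η)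
    (hs : HasCompactSupport η) : ∫ x, deriv η x • F x = -∫ x, η x • v x := by
  have hFc : Continuous F := by
    have : F = fun x => F 0 + ∫ t in (0:ℝ)..x, v t := funext fun x => hF 0 x
    rw [this]
    exact continuous_const.add
      (intervalIntegral.continuous_primitive (intervalIntegrable_of_locallyIntegrable hv) 0)
  have hηc' : Continuous (deriv η) := hη.continuous_deriv (by simp)
  obtain ⟨a, b, hab, hz⟩ := exists_Icc_of_hasCompactSupport hs
  obtain ⟨a', b', hab', hz'⟩ := exists_Icc_of_hasCompactSupport hs.deriv
  set c := min a a'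
  set d := max b b'
  have hca : c ≤ a := min_le_left _ _
  have hca' : c ≤ a' := min_le_right _ _
  have hbd : b ≤ d := le_max_left _ _
  have hbd' : b' ≤ d := le_max_right _ _
  have hcd : c ≤ d := by linarith
  have i1 : ∫ x, deriv η x • F x = ∫ x in c..d, deriv η x • F x := by
    refine (intervalIntegral.integral_eq_integral_of_support_subset fun x hx => ?_).symm
    by_contra hx'
    exact hx (smul_eq_zero_of_left (hz' x fun h => hx' ⟨by linarith [h.1], by linarith [h.2]⟩) _)
  have i2 : ∫ x, η x • v x = ∫ x in c..d, η x • v x := by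
    refine (intervalIntegral.integral_eq_integral_of_support_subset fun x hx => ?_).symm
    by_contra hx'
    exact hx (smul_eq_zero_of_left (hz x fun h => hx' ⟨by linarith [h.1], by linarith [h.2]⟩) _)
  have key := integral_mul_primitive_add hv
    (Complex.continuous_ofReal.comp hηc').locallyIntegrable hF
    (G := fun x => (η x : ℂ)) (fun a b => eq_add_integral_deriv hη a b) c d
  have zc : η c = 0 := hz c fun h => by linarith [h.1]
  have zd : η d = 0 := hz d fun h => by linarith [h.2]
  rw [zc, zd] at key
  rw [i1, i2]
  have e : (fun x => v x * (η x : ℂ) + F x * (Complex.ofReal ∘ deriv η) x) =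
      fun x => η x • v x + deriv η x • F x := by
    funext x
    simp [mul_comm]
  rw [e, intervalIntegral.integral_add ?_ ?_] at key
  · simp only [Complex.ofReal_zero, mul_zero, sub_zero] at key
    linear_combination key
  · exact intervalIntegrable_of_locallyIntegrable (hv.continuous_smul hη.continuous) _ _
  · exact (hηc'.smul hFc).intervalIntegrable _ _

/-- The primitive from the left end of the support vanishes to the left, and to the right because
the mean is zero. -/
theorem exists_testFunction_deriv_eq {η : ℝ → ℝ} (hη : ContDiff ℝ ∞ η) (hs : HasCompactSupport η)
    (h0 : ∫ x, η x = 0) :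
    ∃ ζ : ℝ → ℝ, ContDiff ℝ ∞ ζ ∧ HasCompactSupport ζ ∧ deriv ζ = η := by
  obtain ⟨a, b, hab, hz⟩ := exists_Icc_of_hasCompactSupport hs
  have hd : ∀ x, HasDerivAt (fun x => ∫ t in a..x, η t) (η x) x := fun x =>
    integral_hasDerivAt_right (hη.continuous.intervalIntegrable _ _)
      hη.continuous.stronglyMeasurable.stronglyMeasurableAtFilter hη.continuous.continuousAt
  have hde : deriv (fun x => ∫ t in a..x, η t) = η := funext fun x => (hd x).deriv
  refine ⟨fun x => ∫ t in a..x, η t, ?_, ?_, hde⟩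
  · rw [contDiff_infty_iff_deriv, hde]
    exact ⟨fun x => (hd x).differentiableAt, hη⟩
  · refine HasCompactSupport.intro (isCompact_Icc (a := a) (b := b)) fun x hx => ?_
    rcases lt_or_ge x a with h | h
    · have : ∫ t in a..x, η t = ∫ t in a..x, (0 : ℝ) := by
        refine integral_congr fun t ht => hz t fun h' => ?_
        rw [uIcc_of_ge h.le] at ht
        linarith [ht.2, h'.1]
      simpa using this
    · have hbx : b < x := by
        by_contra hcon
        exact hx ⟨h, not_lt.1 hcon⟩
      change ∫ t in a..x, η t = 0
      rw [← h0]
      refine integral_eq_integral_of_support_subset fun t ht => ?_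
      by_contra ht'
      exact ht (hz t fun h' => ht' ⟨h'.1, by linarith [h'.2]⟩)

/-- The lemma of du Bois-Reymond. -/
theorem ae_eq_const_of_integral_deriv_smul_eq_zero {g : ℝ → ℂ} (hg : LocallyIntegrable g)
    (h : ∀ η : ℝ → ℝ, ContDiff ℝ ∞ η → HasCompactSupport η → ∫ x, deriv η x • g x = 0) :
    ∃ c : ℂ, ∀ᵐ x, g x = c := by
  let f : ContDiffBump (0 : ℝ) := default
  set ρ := f.normed volume with hρ
  have hρs : ContDiff ℝ ∞ ρ := f.contDiff_normed
  have hρc : HasCompactSupport ρ := f.hasCompactSupport_normed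
  have hρi : ∫ x, ρ x = 1 := f.integral_normed
  refine ⟨∫ x, ρ x • g x, ?_⟩
  refine ae_eq_of_integral_contDiff_smul_eq hg (locallyIntegrable_const _) fun η hη hs => ?_
  have hηi : Integrable η := hη.continuous.integrable_of_hasCompactSupport hs
  have hρi' : Integrable ρ := hρs.continuous.integrable_of_hasCompactSupport hρc
  -- Subtracting a multiple of the bump ρ of mass one gives mean zero, so the result is the
  -- derivative of a test function; this identifies the constant as ∫ ρ g.
  obtain ⟨ζ, hζ, hζs, hζd⟩ := exists_testFunction_deriv_eq (η := fun x => η x - (∫ y, η y) * ρ x)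
    (hη.sub (contDiff_const.mul hρs)) (hs.sub hρc.mul_left) (by
      rw [MeasureTheory.integral_sub hηi (hρi'.const_mul _), MeasureTheory.integral_const_mul, hρi, mul_one, sub_self])
  have h1 := h ζ hζ hζs
  rw [hζd] at h1
  have i1 : Integrable fun x => η x • g x :=
    hg.integrable_smul_left_of_hasCompactSupport hη.continuous hs
  have i2 : Integrable fun x => ρ x • g x :=
    hg.integrable_smul_left_of_hasCompactSupport hρs.continuous hρc
  simp only [sub_smul, mul_smul] at h1
  have i3 : Integrable fun x => (∫ y, η y) • ρ x • g x := i2.fun_smul _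
  rw [MeasureTheory.integral_sub i1 i3, MeasureTheory.integral_smul] at h1
  rw [_root_.integral_smul_const, sub_eq_zero.1 h1]

end Primitives

/-! ### Weak derivatives in L² -/

section WeakDerivatives

open Filter Topology

theorem locallyIntegrable_L2 (u : L2) : LocallyIntegrable (u : ℝ → ℂ) :=
  (Lp.memLp u).locallyIntegrable (by norm_num)

theorem add_integral_eq {v : ℝ → ℂ} (hv : LocallyIntegrable v) (c : ℂ) (a b : ℝ) :
    (c + ∫ t in (0:ℝ)..b, v t) = (c + ∫ t in (0:ℝ)..a, v t) + ∫ t in a..b, v t := by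
  rw [add_assoc, intervalIntegral.integral_add_adjacent_intervals] <;>
  exact intervalIntegrable_of_locallyIntegrable hv _ _

/-- A function with a weak derivative in `L²` is a primitive of it. -/
theorem IsWeakDeriv.exists_primitive {u v : L2} (h : IsWeakDeriv u v) :
    ∃ F : ℝ → ℂ, Continuous F ∧ u =ᵐ[volume] F ∧ ∀ a b, F b = F a + ∫ t in a..b, v t := by
  have hv := locallyIntegrable_L2 v
  have hFc : Continuous fun x => ∫ t in (0:ℝ)..x, v t :=
    intervalIntegral.continuous_primitive (intervalIntegrable_of_locallyIntegrable hv) 0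
  have hF : ∀ a b, (∫ t in (0:ℝ)..b, v t) = (∫ t in (0:ℝ)..a, v t) + ∫ t in a..b, v t := by
    intro a b
    simpa using add_integral_eq hv 0 a b
  -- The difference of u and a primitive of v has zero weak derivative.
  obtain ⟨c, hc⟩ := ae_eq_const_of_integral_deriv_smul_eq_zero
    (g := fun x => u x - ∫ t in (0:ℝ)..x, v t)
    ((locallyIntegrable_L2 u).sub hFc.locallyIntegrable) (by
      intro η hη hs
      have hd : Continuous (deriv η) := hη.continuous_deriv (by simp)
      simp only [smul_sub]
      rw [integral_sub (integrable_test_smul u hd hs.deriv)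
        (hFc.locallyIntegrable.integrable_smul_left_of_hasCompactSupport hd hs.deriv), h η hη hs,
        integral_deriv_smul_primitive hv hF (hη.of_le (by exact_mod_cast le_top)) hs, sub_self])
  refine ⟨fun x => c + ∫ t in (0:ℝ)..x, v t, continuous_const.add hFc, ?_, add_integral_eq hv c⟩
  filter_upwards [hc] with x hx
  rw [← hx, sub_add_cancel]

theorem isWeakDeriv_of_primitive {u v : L2} {F : ℝ → ℂ} (hu : u =ᵐ[volume] F)
    (hF : ∀ a b, F b = F a + ∫ t in a..b, v t) : IsWeakDeriv u v := by
  intro η hη hs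
  rw [← integral_deriv_smul_primitive (locallyIntegrable_L2 v) hF
    (hη.of_le (by exact_mod_cast le_top)) hs]
  refine integral_congr_ae ?_
  filter_upwards [hu] with x hx
  rw [hx]

theorem isWeakDeriv_toLp {f f' : ℝ → ℂ} (hd : ∀ x, HasDerivAt f (f' x) x) (hc : Continuous f')
    (hf : MemLp f 2 volume) (hf' : MemLp f' 2 volume) : IsWeakDeriv hf.toLp hf'.toLp := by
  refine isWeakDeriv_of_primitive hf.coeFn_toLp fun a b => ?_
  have h1 : ∫ t in a..b, hf'.toLp f' t = ∫ t in a..b, f' t := by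
    refine intervalIntegral.integral_congr_ae ?_
    filter_upwards [hf'.coeFn_toLp] with x hx _
    exact hx
  rw [h1, intervalIntegral.integral_eq_sub_of_hasDerivAt (fun x _ => hd x)
    (hc.intervalIntegrable _ _)]
  ring

theorem integrable_mul_L2 {f g : ℝ → ℂ} (hf : MemLp f 2 volume) (hg : MemLp g 2 volume) :
    Integrable fun x => f x * g x := by
  have := hg.mul' hf (r := 1)
  exact memLp_one_iff_integrable.1 this

theorem memLp_conj {f : ℝ → ℂ} (hf : MemLp f 2 volume) :
    MemLp (fun x => starRingEnd ℂ (f x)) 2 volume := by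
  refine MemLp.of_le hf (Complex.continuous_conj.comp_aestronglyMeasurable hf.1) ?_
  filter_upwards with x
  simp

/-- Integrability of p gives limits of P at ±∞, and integrability of P forces them to be 0. -/
theorem tendsto_zero_of_primitive {P p : ℝ → ℂ} (hP : Integrable P) (hp : Integrable p)
    (hPp : ∀ a b, P b = P a + ∫ t in a..b, p t) :
    Tendsto P atTop (𝓝 0) ∧ Tendsto P atBot (𝓝 0) := by
  constructor
  · have h1 : Tendsto P atTop (𝓝 (P 0 + ∫ t in Set.Ioi (0:ℝ), p t)) := by
      have h := (intervalIntegral_tendsto_integral_Ioi (0:ℝ) hp.integrableOn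
        tendsto_id).const_add (P 0)
      refine h.congr fun x => (hPp 0 x).symm
    have h0 := IntegrableAtFilter.eq_zero_of_tendsto (f := P) ⟨Set.univ, univ_mem, hP.integrableOn⟩
      (fun s hs => ?_) h1
    · rwa [h0] at h1
    · obtain ⟨a, ha⟩ := mem_atTop_sets.1 hs
      have : volume (Set.Ici a) ≤ volume s := measure_mono fun x hx => ha x hx
      simpa using this
  · have h1 : Tendsto P atBot (𝓝 (P 0 - ∫ t in Set.Iic (0:ℝ), p t)) := by
      have h := (intervalIntegral_tendsto_integral_Iic (0:ℝ) hp.integrableOn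
        tendsto_id).const_sub (P 0)
      refine h.congr fun x => ?_
      have := hPp x 0
      simp only [id]
      rw [this]
      ring
    have h0 := IntegrableAtFilter.eq_zero_of_tendsto (f := P) ⟨Set.univ, univ_mem, hP.integrableOn⟩
      (fun s hs => ?_) h1
    · rwa [h0] at h1
    · obtain ⟨a, ha⟩ := mem_atBot_sets.1 hs
      have : volume (Set.Iic a) ≤ volume s := measure_mono fun x hx => ha x hx
      simpa using this

/-- Integration by parts in `H¹`. -/
theorem IsWeakDeriv.inner_eq_neg {u u' v v' : L2} (hu : IsWeakDeriv u u') (hv : IsWeakDeriv v v') :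
    (inner ℂ u' v : ℂ) = -inner ℂ u v' := by
  obtain ⟨F, hFc, huF, hF⟩ := hu.exists_primitive
  obtain ⟨G, hGc, hvG, hG⟩ := hv.exists_primitive
  have mu := memLp_conj (Lp.memLp u)
  have mu' := memLp_conj (Lp.memLp u')
  have mv := Lp.memLp v
  have mv' := Lp.memLp v'
  have hF' : ∀ a b, starRingEnd ℂ (F b) = starRingEnd ℂ (F a) +
      ∫ t in a..b, starRingEnd ℂ (u' t) := by
    intro a b
    rw [hF a b, map_add]
    congr 1
    simp only [intervalIntegral, map_sub, ← integral_conj]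
  have key := integral_mul_primitive_add (mu'.locallyIntegrable (by norm_num))
    (mv'.locallyIntegrable (by norm_num)) hF' hG
  have i1 : Integrable fun x => starRingEnd ℂ (u' x) * G x := by
    refine (integrable_mul_L2 mu' mv).congr ?_
    filter_upwards [hvG] with x hx
    rw [hx]
  have i2 : Integrable fun x => starRingEnd ℂ (F x) * v' x := by
    refine (integrable_mul_L2 mu mv').congr ?_
    filter_upwards [huF] with x hx
    rw [hx]
  have i3 : Integrable fun x => starRingEnd ℂ (F x) * G x := by
    refine (integrable_mul_L2 mu mv).congr ?_
    filter_upwards [huF, hvG] with x hx hx'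
    rw [hx, hx']
  -- The product of conj F and G is integrable with integrable derivative, so the boundary terms
  -- vanish at ±∞.
  obtain ⟨t1, t2⟩ := tendsto_zero_of_primitive i3 (i1.add i2) fun a b => by
    have := key a b
    simp only [Pi.add_apply]
    rw [this]
    ring
  have t3 := intervalIntegral_tendsto_integral (i1.add i2) tendsto_neg_atTop_atBot tendsto_id
  have t4 : Tendsto (fun x : ℝ => starRingEnd ℂ (F x) * G x - starRingEnd ℂ (F (-x)) * G (-x))
      atTop (𝓝 0) := by
    simpa using t1.sub (t2.comp tendsto_neg_atTop_atBot)
  have h0 : ∫ x, (starRingEnd ℂ (u' x) * G x + starRingEnd ℂ (F x) * v' x) = 0 := by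
    refine tendsto_nhds_unique t3 (t4.congr fun x => ?_)
    exact (key (-x) x).symm
  rw [integral_add i1 i2] at h0
  have e1 : (inner ℂ u' v : ℂ) = ∫ x, starRingEnd ℂ (u' x) * G x := by
    rw [MeasureTheory.L2.inner_def]
    refine integral_congr_ae ?_
    filter_upwards [hvG] with x hx
    rw [RCLike.inner_apply, hx, mul_comm]
  have e2 : (inner ℂ u v' : ℂ) = ∫ x, starRingEnd ℂ (F x) * v' x := by
    rw [MeasureTheory.L2.inner_def]
    refine integral_congr_ae ?_
    filter_upwards [huF] with x hx
    rw [RCLike.inner_apply, hx, mul_comm]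
  rw [e1, e2]
  linear_combination h0

theorem dense_weakDeriv_domain : Dense (weakDeriv.domain : Set L2) := by
  refine (Lp.dense_hasCompactSupport_contDiff (F := ℂ) (μ := (volume : Measure ℝ))
    (by norm_num : (2 : ENNReal) ≠ ⊤)).mono ?_
  rintro f ⟨g, hfg, hs, hg⟩
  have hg' : Continuous (deriv g) := hg.continuous_deriv (by simp)
  have m1 : MemLp g 2 volume := hg.continuous.memLp_of_hasCompactSupport hs
  have m2 : MemLp (deriv g) 2 volume := hg'.memLp_of_hasCompactSupport hs.deriv
  have hf : f = m1.toLp := by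
    rw [← Lp.toLp_coeFn f (Lp.memLp f)]
    exact (MemLp.toLp_eq_toLp_iff _ _).2 hfg
  rw [hf]
  exact LinearPMap.mem_domain_of_mem_graph ((mem_weakDeriv_graph_iff _ _).2
    (isWeakDeriv_toLp (fun x => (hg.differentiable (by simp)).differentiableAt.hasDerivAt)
      hg' m1 m2))

/-- The nontrivial half of ∂* = -∂: taking u to be a real test function turns the adjoint relation
into the definition of the weak derivative. -/
theorem isWeakDeriv_neg_of_forall_inner {x y : L2}
    (h : ∀ u v, IsWeakDeriv u v → (inner ℂ v x : ℂ) = inner ℂ u y) : IsWeakDeriv x (-y) := by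
  intro η hη hs
  have hd : Continuous (deriv η) := hη.continuous_deriv (by simp)
  have m1 : MemLp (fun x => (η x : ℂ)) 2 volume :=
    (Complex.continuous_ofReal.comp hη.continuous).memLp_of_hasCompactSupport
      (hs.comp_left (g := Complex.ofReal) rfl)
  have m2 : MemLp (fun x => ((deriv η x : ℝ) : ℂ)) 2 volume :=
    (Complex.continuous_ofReal.comp hd).memLp_of_hasCompactSupport
      (hs.deriv.comp_left (g := Complex.ofReal) rfl)
  have h1 := h _ _ (isWeakDeriv_toLp (f := fun x => (η x : ℂ))
    (fun x => ((hη.differentiable (by simp)).differentiableAt.hasDerivAt).ofReal_comp)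
    (Complex.continuous_ofReal.comp hd) m1 m2)
  rw [MeasureTheory.L2.inner_def, MeasureTheory.L2.inner_def] at h1
  have e1 : ∫ t, deriv η t • x t = ∫ t, (inner ℂ (m2.toLp _ t) (x t) : ℂ) := by
    refine integral_congr_ae ?_
    filter_upwards [m2.coeFn_toLp] with t ht
    rw [ht, RCLike.inner_apply, Complex.conj_ofReal, mul_comm]
    exact (Complex.real_smul (x := deriv η t) (z := x t))
  have e2 : ∫ t, η t • (-y : L2) t = -∫ t, (inner ℂ (m1.toLp _ t) (y t) : ℂ) := by
    rw [← integral_neg]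
    refine integral_congr_ae ?_
    filter_upwards [m1.coeFn_toLp, Lp.coeFn_neg y] with t ht hy
    rw [ht, hy, RCLike.inner_apply, Complex.conj_ofReal, mul_comm, Pi.neg_apply, smul_neg,
      Complex.real_smul]
  rw [e1, e2, h1, neg_neg]

/-- A constant function on the line is in L² only if it is zero. -/
theorem IsWeakDeriv.eq_zero_of_zero {u : L2} (h : IsWeakDeriv u 0) : u = 0 := by
  obtain ⟨F, -, huF, hF⟩ := h.exists_primitive
  have h0 : ∀ a b, ∫ t in a..b, ((0 : L2) : ℝ → ℂ) t = 0 := by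
    intro a b
    rw [intervalIntegral.integral_congr_ae (g := fun _ => 0), intervalIntegral.integral_zero]
    filter_upwards [Lp.coeFn_zero ℂ 2 (volume : Measure ℝ)] with x hx _
    exact hx
  have hc : u =ᵐ[volume] fun _ => F 0 := by
    filter_upwards [huF] with x hx
    rw [hx, hF 0 x, h0, add_zero]
  have hm : MemLp (fun _ : ℝ => F 0) 2 volume := (memLp_congr_ae hc).1 (Lp.memLp u)
  rw [memLp_const_iff (by norm_num) (by norm_num)] at hm
  have hF0 : F 0 = 0 := by
    rcases hm with hm | hm
    · exact hm
    · simp at hm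
  rw [Lp.eq_zero_iff_ae_eq_zero]
  filter_upwards [hc] with x hx
  rw [hx, hF0]; rfl

theorem IsWeakDeriv.add {u v u' v' : L2} (h : IsWeakDeriv u v) (h' : IsWeakDeriv u' v') :
    IsWeakDeriv (u + u') (v + v') :=
  weakDerivGraph.add_mem (x := (u, v)) (y := (u', v')) h h'

theorem IsWeakDeriv.sub {u v u' v' : L2} (h : IsWeakDeriv u v) (h' : IsWeakDeriv u' v') :
    IsWeakDeriv (u - u') (v - v') :=
  weakDerivGraph.sub_mem (x := (u, v)) (y := (u', v')) h h'

end WeakDerivatives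

/-! ### Multiplication operators and the product rule -/

section Multiplication

theorem mem_mulOp_graph_iff (f : ℝ → ℝ) (u w : L2) :
    (u, w) ∈ (mulOp f).graph ↔ w =ᵐ[volume] fun x => (f x : ℂ) * u x := by
  rw [LinearPMap.mem_graph_iff]
  constructor
  · rintro ⟨y, rfl, rfl⟩
    exact MemLp.coeFn_toLp (memLp_of_mem_mulDomain y.2)
  · intro h
    have hu : u ∈ mulDomain f := (memLp_congr_ae h).1 (Lp.memLp w)
    refine ⟨⟨u, hu⟩, rfl, ?_⟩
    change MemLp.toLp (fun x => (f x : ℂ) * u x) (memLp_of_mem_mulDomain hu) = w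
    conv_rhs => rw [← Lp.toLp_coeFn w (Lp.memLp w)]
    exact (MemLp.toLp_eq_toLp_iff _ _).2 h.symm

/-- `M` is the operator of multiplication by the function `f`. -/
def IsMulBy (M : L2 →L[ℂ] L2) (f : ℝ → ℝ) : Prop :=
  ∀ u : L2, M u =ᵐ[volume] fun x => (f x : ℂ) * u x

/-- Replaces `mulOp f` by an everywhere defined bounded operator, so that later domain questions
concern weak derivatives only. -/
theorem exists_isMulBy {f : ℝ → ℝ} (hf : Measurable f) {C : ℝ} (hC : ∀ x, |f x| ≤ C) :
    ∃ M, IsMulBy M f := by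
  have hdom := mulOp_domain_eq_top hf hC
  let T : L2 →ₗ[ℂ] L2 :=
    (mulOp f).toFun.comp (LinearMap.codRestrict _ LinearMap.id fun u => hdom ▸ Submodule.mem_top)
  have hT : ∀ u, T u =ᵐ[volume] fun x => (f x : ℂ) * u x := fun u =>
    (mem_mulOp_graph_iff f u (T u)).1 (LinearPMap.mem_graph (mulOp f) ⟨u, _⟩)
  refine ⟨T.mkContinuous C fun u => ?_, hT⟩
  refine Lp.norm_le_mul_norm_of_ae_le_mul ?_
  filter_upwards [hT u] with x hx
  rw [hx, norm_mul, Complex.norm_real, Real.norm_eq_abs]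
  exact mul_le_mul_of_nonneg_right (hC x) (norm_nonneg _)

theorem IsMulBy.mem_graph_iff {M : L2 →L[ℂ] L2} {f : ℝ → ℝ} (hM : IsMulBy M f) (u w : L2) :
    (u, w) ∈ (mulOp f).graph ↔ w = M u := by
  rw [mem_mulOp_graph_iff]
  constructor
  · intro h
    exact Lp.ext (h.trans (hM u).symm)
  · rintro rfl
    exact hM u

theorem IsMulBy.inner_left {M : L2 →L[ℂ] L2} {f : ℝ → ℝ} (hM : IsMulBy M f) (u v : L2) :
    (inner ℂ (M u) v : ℂ) = inner ℂ u (M v) := by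
  rw [MeasureTheory.L2.inner_def, MeasureTheory.L2.inner_def]
  refine integral_congr_ae ?_
  filter_upwards [hM u, hM v] with x hu hv
  rw [hu, hv, RCLike.inner_apply, RCLike.inner_apply, map_mul, Complex.conj_ofReal]
  ring

theorem IsMulBy.re_inner_nonneg {M : L2 →L[ℂ] L2} {f : ℝ → ℝ} (hM : IsMulBy M f)
    (hf : ∀ x, 0 ≤ f x) (u : L2) : 0 ≤ (inner ℂ (M u) u : ℂ).re := by
  have e : (inner ℂ (M u) u : ℂ) = ((∫ x, f x * ‖u x‖ ^ 2 : ℝ) : ℂ) := by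
    rw [MeasureTheory.L2.inner_def, ← integral_complex_ofReal]
    refine integral_congr_ae ?_
    filter_upwards [hM u] with x hu
    rw [hu, RCLike.inner_apply, map_mul, Complex.conj_ofReal, mul_left_comm, Complex.mul_conj,
      Complex.normSq_eq_norm_sq]
    push_cast
    rfl
  rw [e, Complex.ofReal_re]
  exact integral_nonneg fun x => mul_nonneg (hf x) (by positivity)

/-- The product rule. -/
theorem IsWeakDeriv.mul {u v : L2} (h : IsWeakDeriv u v) {f : ℝ → ℝ} (hf : ContDiff ℝ ∞ f)
    {M M' : L2 →L[ℂ] L2} (hM : IsMulBy M f) (hM' : IsMulBy M' (deriv f)) :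
    IsWeakDeriv (M u) (M' u + M v) := by
  intro η hη hs
  have hfd : Continuous (deriv f) := hf.continuous_deriv (by simp)
  have hηd : Continuous (deriv η) := hη.continuous_deriv (by simp)
  have h1 := h (fun x => η x * f x) (hη.mul hf) hs.mul_right
  have e0 : ∀ x, deriv (fun x => η x * f x) x = deriv η x * f x + η x * deriv f x := fun x =>
    (((hη.differentiable (by simp)).differentiableAt.hasDerivAt).mul
      ((hf.differentiable (by simp)).differentiableAt.hasDerivAt)).deriv
  have i1 : Integrable fun x => (deriv η x * f x) • u x :=
    integrable_test_smul u (hηd.mul hf.continuous) hs.deriv.mul_right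
  have i2 : Integrable fun x => (η x * deriv f x) • u x :=
    integrable_test_smul u (hη.continuous.mul hfd) hs.mul_right
  have i3 : Integrable fun x => (η x * f x) • v x :=
    integrable_test_smul v (hη.continuous.mul hf.continuous) hs.mul_right
  simp only [e0, add_smul] at h1
  rw [integral_add i1 i2] at h1
  have e1 : ∫ x, deriv η x • M u x = ∫ x, (deriv η x * f x) • u x := by
    refine integral_congr_ae ?_
    filter_upwards [hM u] with x hx
    rw [hx, mul_smul, Complex.real_smul (x := f x)]
  have e2 : ∫ x, η x • (M' u + M v : L2) x =
      (∫ x, (η x * deriv f x) • u x) + ∫ x, (η x * f x) • v x := by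
    rw [← integral_add i2 i3]
    refine integral_congr_ae ?_
    filter_upwards [hM' u, hM v, Lp.coeFn_add (M' u) (M v)] with x hx hx' hx''
    rw [hx'', Pi.add_apply, hx, hx', mul_smul, mul_smul, Complex.real_smul (x := f x),
      Complex.real_smul (x := deriv f x), smul_add]
  rw [e1, e2]
  linear_combination h1

end Multiplication

/-! ### The factorizations and their quadratic forms -/

section Supersymmetry

variable {φ : ℝ → ℝ} {M : L2 →L[ℂ] L2}

theorem mem_U_graph_iff (hM : IsMulBy M (logDerivative φ)) (u w : L2) :
    (u, w) ∈ (U φ).graph ↔ ∃ v, IsWeakDeriv u v ∧ w = v - M u := by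
  rw [U, mem_sub_graph_iff]
  constructor
  · rintro ⟨a, b, ha, hb, rfl⟩
    exact ⟨a, (mem_weakDeriv_graph_iff _ _).1 ha, by rw [(hM.mem_graph_iff _ _).1 hb]⟩
  · rintro ⟨v, hv, rfl⟩
    exact ⟨v, M u, (mem_weakDeriv_graph_iff _ _).2 hv, (hM.mem_graph_iff _ _).2 rfl, rfl⟩

theorem mem_Ustar_graph_iff (hM : IsMulBy M (logDerivative φ)) (u w : L2) :
    (u, w) ∈ (Ustar φ).graph ↔ ∃ v, IsWeakDeriv u v ∧ w = -v - M u := by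
  rw [Ustar, mem_sub_graph_iff]
  constructor
  · rintro ⟨a, b, ha, hb, rfl⟩
    rw [mem_neg_graph_iff] at ha
    exact ⟨-a, (mem_weakDeriv_graph_iff _ _).1 ha, by rw [(hM.mem_graph_iff _ _).1 hb, neg_neg]⟩
  · rintro ⟨v, hv, rfl⟩
    exact ⟨-v, M u, (mem_neg_graph_iff _ _ _).2 ((mem_weakDeriv_graph_iff _ _).2 (by rwa [neg_neg])),
      (hM.mem_graph_iff _ _).2 rfl, rfl⟩

theorem mem_schrodinger_graph_iff {W : ℝ → ℝ} {N : L2 →L[ℂ] L2} (hN : IsMulBy N W) (u w : L2) :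
    (u, w) ∈ (schrodinger W).graph ↔
      ∃ v c, IsWeakDeriv u v ∧ IsWeakDeriv v c ∧ w = -c + N u := by
  rw [schrodinger, mem_add_graph_iff]
  constructor
  · rintro ⟨a, b, ha, hb, rfl⟩
    rw [mem_neg_graph_iff, mem_opComp_graph_iff] at ha
    obtain ⟨v, h1, h2⟩ := ha
    exact ⟨v, -a, (mem_weakDeriv_graph_iff _ _).1 h1, (mem_weakDeriv_graph_iff _ _).1 h2,
      by rw [(hN.mem_graph_iff _ _).1 hb, neg_neg]⟩
  · rintro ⟨v, c, h1, h2, rfl⟩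
    refine ⟨-c, N u, ?_, (hN.mem_graph_iff _ _).2 rfl, rfl⟩
    rw [mem_neg_graph_iff, neg_neg, mem_opComp_graph_iff]
    exact ⟨v, (mem_weakDeriv_graph_iff _ _).2 h1, (mem_weakDeriv_graph_iff _ _).2 h2⟩

/-- Multiplication by the bounded real function φ'/φ is symmetric and ∂* = -∂ on H¹. Together with
`U_graph_eq`, this supplies the mutual adjointness needed for von Neumann's theorem. -/
theorem Ustar_graph_eq (hM : IsMulBy M (logDerivative φ)) :
    (Ustar φ).graph = (U φ).graph.adjoint := by
  ext ⟨x, y⟩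
  rw [mem_Ustar_graph_iff hM, Submodule.mem_adjoint_iff]
  constructor
  · rintro ⟨v, hv, rfl⟩ a b hab
    obtain ⟨c, hc, rfl⟩ := (mem_U_graph_iff hM _ _).1 hab
    simp only [inner_sub_left, inner_sub_right, inner_neg_right]
    rw [hM.inner_left, hc.inner_eq_neg hv]
    ring
  · intro h
    refine ⟨-(y + M x), isWeakDeriv_neg_of_forall_inner fun u v huv => ?_, by abel⟩
    have := h u (v - M u) ((mem_U_graph_iff hM _ _).2 ⟨v, huv, rfl⟩)
    simp only [inner_sub_left] at this
    rw [hM.inner_left] at this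
    rw [inner_add_right]
    linear_combination this

theorem U_graph_eq (hM : IsMulBy M (logDerivative φ)) :
    (U φ).graph = (Ustar φ).graph.adjoint := by
  ext ⟨x, y⟩
  rw [mem_U_graph_iff hM, Submodule.mem_adjoint_iff]
  constructor
  · rintro ⟨v, hv, rfl⟩ a b hab
    obtain ⟨c, hc, rfl⟩ := (mem_Ustar_graph_iff hM _ _).1 hab
    simp only [inner_sub_left, inner_sub_right, inner_neg_left]
    rw [hM.inner_left, hc.inner_eq_neg hv]
    ring
  · intro h
    refine ⟨y + M x, ?_, by abel⟩
    rw [← neg_neg (y + M x)]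
    refine isWeakDeriv_neg_of_forall_inner fun u v huv => ?_
    have := h u (-v - M u) ((mem_Ustar_graph_iff hM _ _).2 ⟨v, huv, rfl⟩)
    simp only [inner_sub_left, inner_neg_left] at this
    rw [hM.inner_left] at this
    rw [inner_neg_right, inner_add_right]
    linear_combination -this

theorem U_adjoint_eq (hM : IsMulBy M (logDerivative φ)) : (U φ).adjoint = Ustar φ := by
  have hd : Dense ((U φ).domain : Set L2) := by
    refine dense_weakDeriv_domain.mono fun u hu => ?_
    obtain ⟨v, hv⟩ := LinearPMap.mem_domain_iff.1 hu
    exact LinearPMap.mem_domain_of_mem_graph ((mem_U_graph_iff hM u _).2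
      ⟨v, (mem_weakDeriv_graph_iff _ _).1 hv, rfl⟩)
  apply LinearPMap.eq_of_eq_graph
  rw [LinearPMap.adjoint_graph_eq_graph_adjoint hd, Ustar_graph_eq hM]

/-- Operator form of the Riccati equation; ε = 1 serves U*U and ε = -1 serves UU*. -/
theorem IsMulBy.mul_self_add {h q : ℝ → ℝ} {N M' : L2 →L[ℂ] L2} {c : ℝ} {ε : ℝ}
    (hM : IsMulBy M h) (hM' : IsMulBy M' (deriv h)) (hN : IsMulBy N q)
    (hq : ∀ x, h x ^ 2 + ε * deriv h x = q x + c) (u : L2) :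
    M (M u) + (ε : ℂ) • M' u = N u + (c : ℂ) • u := by
  apply Lp.ext
  filter_upwards [hM (M u), hM u, hM' u, hN u, Lp.coeFn_add (M (M u)) ((ε : ℂ) • M' u),
    Lp.coeFn_smul (ε : ℂ) (M' u), Lp.coeFn_add (N u) ((c : ℂ) • u), Lp.coeFn_smul (c : ℂ) u]
    with x h1 h2 h3 h4 h5 h6 h7 h8
  rw [h5, h7, Pi.add_apply, Pi.add_apply, h6, h8, Pi.smul_apply, Pi.smul_apply, h1, h2, h3, h4]
  have := congrArg (fun r : ℝ => (r : ℂ)) (hq x)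
  simp only [Complex.ofReal_add, Complex.ofReal_mul, Complex.ofReal_pow] at this
  simp only [smul_eq_mul]
  linear_combination (u x) * this

/-- With h = φ'/φ, -(u' - hu)' - h(u' - hu) = -u'' + (h' + h²)u. The domains agree because hu is in
H¹ whenever u is, so u' - hu is in H¹ exactly when u' is. -/
theorem schrodinger_eq_Ustar_U {W : ℝ → ℝ} {N M' : L2 →L[ℂ] L2} {c : ℝ}
    (hsm : ContDiff ℝ ∞ (logDerivative φ)) (hM : IsMulBy M (logDerivative φ))
    (hM' : IsMulBy M' (deriv (logDerivative φ))) (hN : IsMulBy N W)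
    (hW : ∀ x, deriv (logDerivative φ) x = W x + c - logDerivative φ x ^ 2) :
    schrodinger W = opSubConst (opComp (Ustar φ) (U φ)) c := by
  apply LinearPMap.eq_of_eq_graph
  ext ⟨u, w⟩
  rw [mem_opSubConst_graph_iff, mem_opComp_graph_iff, mem_schrodinger_graph_iff hN]
  have key := hM.mul_self_add (c := c) (ε := 1) hM' hN (fun x => by rw [hW x]; ring) u
  rw [Complex.ofReal_one, one_smul] at key
  constructor
  · rintro ⟨v, d, h1, h2, rfl⟩
    refine ⟨v - M u, (mem_U_graph_iff hM _ _).2 ⟨v, h1, rfl⟩, (mem_Ustar_graph_iff hM _ _).2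
      ⟨d - (M' u + M v), h2.sub (h1.mul hsm hM hM'), ?_⟩⟩
    rw [add_assoc, ← key, map_sub]
    abel
  · rintro ⟨y, h1, h2⟩
    obtain ⟨v, hv, rfl⟩ := (mem_U_graph_iff hM _ _).1 h1
    obtain ⟨b, hb, hw⟩ := (mem_Ustar_graph_iff hM _ _).1 h2
    refine ⟨v, b + (M' u + M v), hv, ?_, ?_⟩
    · simpa using hb.add (hv.mul hsm hM hM')
    · rw [map_sub] at hw
      rw [eq_sub_of_add_eq hw, eq_sub_iff_add_eq.2 key]
      abel

/-- As for U*U, with the sign of h' reversed: UU*u = -u'' + (h² - h')u. -/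
theorem schrodinger_eq_U_Ustar {W : ℝ → ℝ} {N M' : L2 →L[ℂ] L2} {c : ℝ}
    (hsm : ContDiff ℝ ∞ (logDerivative φ)) (hM : IsMulBy M (logDerivative φ))
    (hM' : IsMulBy M' (deriv (logDerivative φ))) (hN : IsMulBy N W)
    (hW : ∀ x, W x + c = logDerivative φ x ^ 2 - deriv (logDerivative φ) x) :
    schrodinger W = opSubConst (opComp (U φ) (Ustar φ)) c := by
  apply LinearPMap.eq_of_eq_graph
  ext ⟨u, w⟩
  rw [mem_opSubConst_graph_iff, mem_opComp_graph_iff, mem_schrodinger_graph_iff hN]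
  have key := hM.mul_self_add (c := c) (ε := -1) hM' hN (fun x => by rw [hW x]; ring) u
  rw [Complex.ofReal_neg, Complex.ofReal_one, neg_one_smul] at key
  have hneg : ∀ {a b : L2}, IsWeakDeriv a b → IsWeakDeriv (-a) (-b) := fun {a b} h =>
    weakDerivGraph.neg_mem (x := (a, b)) h
  constructor
  · rintro ⟨v, d, h1, h2, rfl⟩
    refine ⟨-v - M u, (mem_Ustar_graph_iff hM _ _).2 ⟨v, h1, rfl⟩, (mem_U_graph_iff hM _ _).2
      ⟨-d - (M' u + M v), (hneg h2).sub (h1.mul hsm hM hM'), ?_⟩⟩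
    rw [add_assoc, ← key, map_sub, map_neg]
    abel
  · rintro ⟨y, h1, h2⟩
    obtain ⟨v, hv, rfl⟩ := (mem_Ustar_graph_iff hM _ _).1 h1
    obtain ⟨b, hb, hw⟩ := (mem_U_graph_iff hM _ _).1 h2
    refine ⟨v, -(b + (M' u + M v)), hv, ?_, ?_⟩
    · simpa using hneg (hb.add (hv.mul hsm hM hM'))
    · rw [map_sub, map_neg] at hw
      rw [eq_sub_of_add_eq hw, eq_sub_iff_add_eq.2 key]
      abel

/-- The form of `-∂ₓ² + W` is `‖u'‖² + ⟨W u, u⟩`. -/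
theorem schrodinger_inner_eq {W : ℝ → ℝ} {N : L2 →L[ℂ] L2} (hN : IsMulBy N W) {u w : L2}
    (h : (u, w) ∈ (schrodinger W).graph) :
    ∃ v, IsWeakDeriv u v ∧ (inner ℂ w u : ℂ) = ((‖v‖ ^ 2 : ℝ) : ℂ) + inner ℂ (N u) u := by
  obtain ⟨v, c, h1, h2, rfl⟩ := (mem_schrodinger_graph_iff hN _ _).1 h
  refine ⟨v, h1, ?_⟩
  rw [inner_add_left, inner_neg_left, h2.inner_eq_neg h1, neg_neg, inner_self_eq_norm_sq_to_K]
  push_cast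
  rfl

theorem schrodinger_re_inner_nonneg {W : ℝ → ℝ} {N : L2 →L[ℂ] L2} (hN : IsMulBy N W)
    (hW : ∀ x, 0 ≤ W x) {u w : L2} (h : (u, w) ∈ (schrodinger W).graph) :
    0 ≤ (inner ℂ w u : ℂ).re := by
  obtain ⟨v, -, hv⟩ := schrodinger_inner_eq hN h
  rw [hv, Complex.add_re, Complex.ofReal_re]
  exact add_nonneg (by positivity) (hN.re_inner_nonneg hW u)

/-- An eigenvector satisfies z‖u‖² = ‖u'‖² + ⟨Wu, u⟩, which makes z real. Positivity is strict
because u' = 0 would force u = 0 in L². -/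
theorem schrodinger_pointSpectrum_pos {W : ℝ → ℝ} {N : L2 →L[ℂ] L2} (hN : IsMulBy N W)
    (hW : ∀ x, 0 ≤ W x) : ∀ z ∈ pointSpectrum (schrodinger W), ∃ r : ℝ, 0 < r ∧ z = r := by
  rintro z ⟨u, hu, hu0⟩
  obtain ⟨v, huv, hv⟩ := schrodinger_inner_eq (u := u) (w := z • u) hN hu
  have hN1 := hN.re_inner_nonneg hW u
  have hNr : (inner ℂ (N u) u : ℂ).im = 0 := by
    have : (starRingEnd ℂ) (inner ℂ (N u) u : ℂ) = inner ℂ (N u) u := by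
      rw [inner_conj_symm, hN.inner_left]
    exact Complex.conj_eq_iff_im.1 this
  have hup : 0 < ‖u‖ ^ 2 := by positivity
  rw [inner_smul_left, inner_self_eq_norm_sq_to_K] at hv
  have hv' : (starRingEnd ℂ z) * ((‖u‖ ^ 2 : ℝ) : ℂ) = ((‖v‖ ^ 2 : ℝ) : ℂ) + inner ℂ (N u) u := by
    rw [← hv]
    push_cast
    rfl
  have hre := congrArg Complex.re hv'
  have him := congrArg Complex.im hv'
  simp only [Complex.mul_re, Complex.mul_im, Complex.conj_re, Complex.conj_im, Complex.ofReal_re,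
    Complex.ofReal_im, Complex.add_re, Complex.add_im, hNr, mul_zero, zero_add, sub_zero] at hre him
  have hzim : z.im = 0 := by
    rcases mul_eq_zero.1 him with h | h
    · linarith
    · exact absurd h hup.ne'
  refine ⟨z.re, ?_, Complex.ext rfl (by simp [hzim])⟩
  have hv0 : v ≠ 0 := by
    rintro rfl
    exact hu0 huv.eq_zero_of_zero
  have : 0 < ‖v‖ ^ 2 := by positivity
  by_contra hcon
  nlinarith [mul_nonneg (neg_nonneg.2 (not_lt.1 hcon)) hup.le]

/-- The kernel of `U = ∂ₓ - φ' / φ` is spanned by `φ`. -/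
theorem eq_smul_of_isWeakDeriv_logDerivative (hφ : ContDiff ℝ 2 φ) (hpos : ∀ x, 0 < φ x)
    (hM : IsMulBy M (logDerivative φ)) (hφ2 : MemLp (fun x => (φ x : ℂ)) 2 volume) {u : L2}
    (hu : IsWeakDeriv u (M u)) : ∃ c : ℂ, c • hφ2.toLp = u := by
  obtain ⟨F, hFc, huF, hF⟩ := hu.exists_primitive
  have hφd : ∀ x, HasDerivAt φ (deriv φ x) x := fun x =>
    (hφ.differentiable (by simp)).differentiableAt.hasDerivAt
  have hφ' : Continuous (deriv φ) := hφ.continuous_deriv (by norm_num)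
  have hlc : Continuous (logDerivative φ) := hφ'.div hφ.continuous fun x => (hpos x).ne'
  have hgc : Continuous fun x => (logDerivative φ x : ℂ) * F x :=
    (Complex.continuous_ofReal.comp hlc).mul hFc
  -- F is a primitive of the continuous function (φ'/φ)F, hence C¹, and F/φ then has zero
  -- derivative.
  have hFd : ∀ x, HasDerivAt F ((logDerivative φ x : ℂ) * F x) x := by
    intro x
    have e : F = fun x => F 0 + ∫ t in (0:ℝ)..x, (logDerivative φ t : ℂ) * F t := by
      funext y
      rw [hF 0 y]
      congr 1
      refine intervalIntegral.integral_congr_ae ?_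
      filter_upwards [hM u, huF] with t h1 h2 _
      rw [h1, h2]
    rw [e]
    refine HasDerivAt.const_add _ ?_
    rw [← e]
    exact intervalIntegral.integral_hasDerivAt_right (hgc.intervalIntegrable _ _)
      hgc.stronglyMeasurable.stronglyMeasurableAtFilter hgc.continuousAt
  have hφ0 : ∀ x, (φ x : ℂ) ≠ 0 := fun x => Complex.ofReal_ne_zero.2 (hpos x).ne'
  have hq : ∀ x, HasDerivAt (fun x => F x / (φ x : ℂ)) 0 x := by
    intro x
    have := (hFd x).div (hφd x).ofReal_comp (hφ0 x)
    convert! this using 1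
    rw [logDerivative]
    have := hφ0 x
    push_cast
    field_simp
    ring
  have hconst : ∀ x, F x / (φ x : ℂ) = F 0 / (φ 0 : ℂ) := fun x =>
    is_const_of_deriv_eq_zero (fun x => (hq x).differentiableAt) (fun x => (hq x).deriv) x 0
  refine ⟨F 0 / (φ 0 : ℂ), Lp.ext ?_⟩
  filter_upwards [huF, hφ2.coeFn_toLp, Lp.coeFn_smul (F 0 / (φ 0 : ℂ)) hφ2.toLp] with x h1 h2 h3
  rw [h3, Pi.smul_apply, h2, h1, ← hconst x, smul_eq_mul, div_mul_cancel₀ _ (hφ0 x)]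

theorem isWeakDeriv_toLp_self (hφ : ContDiff ℝ 2 φ) (hpos : ∀ x, 0 < φ x)
    (hM : IsMulBy M (logDerivative φ)) {C : ℝ} (hC : ∀ x, |logDerivative φ x| ≤ C)
    (hφ2 : MemLp (fun x => (φ x : ℂ)) 2 volume) : IsWeakDeriv hφ2.toLp (M hφ2.toLp) := by
  have hφd : ∀ x, HasDerivAt φ (deriv φ x) x := fun x =>
    (hφ.differentiable (by simp)).differentiableAt.hasDerivAt
  have hφ' : Continuous (deriv φ) := hφ.continuous_deriv (by norm_num)
  have hφ'c : Continuous fun x => ((deriv φ x : ℝ) : ℂ) := Complex.continuous_ofReal.comp hφ'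
  have e : ∀ x, deriv φ x = logDerivative φ x * φ x := fun x =>
    (div_mul_cancel₀ _ (hpos x).ne').symm
  have hm : MemLp (fun x => ((deriv φ x : ℝ) : ℂ)) 2 volume := by
    refine MemLp.of_le_mul (c := C) hφ2 hφ'c.aestronglyMeasurable ?_
    filter_upwards with x
    rw [e x, Complex.ofReal_mul, norm_mul, Complex.norm_real, Real.norm_eq_abs]
    exact mul_le_mul_of_nonneg_right (hC x) (norm_nonneg _)
  have h1 := isWeakDeriv_toLp (fun x => (hφd x).ofReal_comp) hφ'c hφ2 hm
  convert! h1 using 1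
  apply Lp.ext
  filter_upwards [hM hφ2.toLp, hφ2.coeFn_toLp, hm.coeFn_toLp] with x h1 h2 h3
  rw [h1, h2, h3, e x, Complex.ofReal_mul]

end Supersymmetry

/-! ### Global linear initial value problems -/

section LinearODE

open Filter Topology Real BoundedContinuousFunction

variable {E : Type*} [NormedAddCommGroup E] [NormedSpace ℝ E] [CompleteSpace E]

/-- Global solvability of the linear initial value problem `X' = A(t) X` with bounded `A`. -/
theorem exists_solution_linear_ODE {A : ℝ → E →L[ℝ] E} (hA : Continuous A) {K : ℝ}
    (hK : ∀ t, ‖A t‖ ≤ K) (x₀ : E) :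
    ∃ X : ℝ → E, X 0 = x₀ ∧ ∀ t, HasDerivAt X (A t (X t)) t := by
  have hK0 : 0 ≤ K := (norm_nonneg _).trans (hK 0)
  -- Write X = cosh(kt)·Y with Y bounded. As ∫₀ᵗ cosh(kr) dr = sinh(kt)/k and K/k ≤ 1/2, the Picard
  -- map is a 1/2-contraction in Y on the whole line at once; the +1 keeps k positive when K = 0.
  set k : ℝ := 2 * (K + 1) with hk
  have hkp : 0 < k := by positivity
  have hcosh : Continuous fun t : ℝ => cosh (k * t) := by fun_prop
  have hint : ∀ t : ℝ, ∫ r in (0:ℝ)..t, cosh (k * r) = sinh (k * t) / k := by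
    intro t
    have hd : ∀ x ∈ Set.uIcc 0 t, HasDerivAt (fun x => sinh (k * x) / k) (cosh (k * x)) x := by
      intro x _
      have := ((hasDerivAt_sinh (k * x)).comp x ((hasDerivAt_id x).const_mul k)).div_const k
      convert! this using 1
      field_simp
    rw [intervalIntegral.integral_eq_sub_of_hasDerivAt hd (hcosh.intervalIntegrable _ _)]
    simp
  have hcont : ∀ Y : ℝ →ᵇ E, Continuous fun r => A r (cosh (k * r) • Y r) := fun Y =>
    hA.clm_apply (hcosh.smul Y.continuous)
  have hbound : ∀ (Y : ℝ →ᵇ E) (t : ℝ),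
      ‖(cosh (k * t))⁻¹ • ∫ r in (0:ℝ)..t, A r (cosh (k * r) • Y r)‖ ≤ 1 / 2 * ‖Y‖ := by
    intro Y t
    have h1 : ‖∫ r in (0:ℝ)..t, A r (cosh (k * r) • Y r)‖ ≤
        |∫ r in (0:ℝ)..t, K * ‖Y‖ * cosh (k * r)| := by
      refine intervalIntegral.norm_integral_le_abs_of_norm_le (ae_of_all _ fun r => ?_)
        ((hcosh.const_mul _).intervalIntegrable _ _)
      calc ‖A r (cosh (k * r) • Y r)‖ ≤ ‖A r‖ * ‖cosh (k * r) • Y r‖ := (A r).le_opNorm _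
        _ = ‖A r‖ * (cosh (k * r) * ‖Y r‖) := by
          rw [norm_smul, Real.norm_of_nonneg (cosh_pos _).le]
        _ ≤ K * (cosh (k * r) * ‖Y‖) := by
          gcongr
          · exact hK r
          · exact Y.norm_coe_le_norm r
        _ = K * ‖Y‖ * cosh (k * r) := by ring
    rw [intervalIntegral.integral_const_mul, hint, abs_mul,
      abs_of_nonneg (by positivity : 0 ≤ K * ‖Y‖), abs_div, abs_of_pos hkp] at h1
    have h2 : |sinh (k * t)| ≤ cosh (k * t) := by
      rw [abs_le]
      constructor
      · have := exp_pos (k * t)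
        rw [← cosh_add_sinh] at this
        linarith
      · exact (sinh_lt_cosh _).le
    have hcp := cosh_pos (k * t)
    rw [norm_smul, norm_inv, Real.norm_of_nonneg hcp.le, inv_mul_le_iff₀ hcp]
    refine h1.trans ?_
    have h3 : K / k ≤ 1 / 2 := by
      rw [div_le_iff₀ hkp, hk]
      linarith
    calc K * ‖Y‖ * (|sinh (k * t)| / k) = (K / k) * ‖Y‖ * |sinh (k * t)| := by ring
      _ ≤ 1 / 2 * ‖Y‖ * cosh (k * t) := by gcongr
      _ = cosh (k * t) * (1 / 2 * ‖Y‖) := by ring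
  have hprim : ∀ Y : ℝ →ᵇ E, Continuous fun t => ∫ r in (0:ℝ)..t, A r (cosh (k * r) • Y r) :=
    fun Y => intervalIntegral.continuous_primitive (fun _ _ => (hcont Y).intervalIntegrable _ _) 0
  have hci : Continuous fun t : ℝ => (cosh (k * t))⁻¹ := hcosh.inv₀ fun t => (cosh_pos _).ne'
  let Φ : (ℝ →ᵇ E) → (ℝ →ᵇ E) := fun Y => ofNormedAddCommGroup
    (fun t => (cosh (k * t))⁻¹ • x₀ + (cosh (k * t))⁻¹ • ∫ r in (0:ℝ)..t, A r (cosh (k * r) • Y r))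
    ((hci.smul continuous_const).add (hci.smul (hprim Y))) (‖x₀‖ + 1 / 2 * ‖Y‖) (by
      intro t
      refine (norm_add_le _ _).trans (add_le_add ?_ (hbound Y t))
      rw [norm_smul, norm_inv, Real.norm_of_nonneg (cosh_pos _).le]
      refine mul_le_of_le_one_left (norm_nonneg _) ?_
      exact inv_le_one_of_one_le₀ (one_le_cosh _))
  have hΦ : ContractingWith (1 / 2) Φ := by
    refine ⟨by norm_num, LipschitzWith.of_dist_le_mul fun Y Z => ?_⟩
    rw [dist_eq_norm, dist_eq_norm]
    refine (norm_le (by positivity)).2 fun t => ?_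
    have e : (Φ Y - Φ Z) t =
        (cosh (k * t))⁻¹ • ∫ r in (0:ℝ)..t, A r (cosh (k * r) • (Y - Z) r) := by
      change ((cosh (k * t))⁻¹ • x₀ + (cosh (k * t))⁻¹ • ∫ r in (0:ℝ)..t, A r (cosh (k * r) • Y r)) -
        ((cosh (k * t))⁻¹ • x₀ + (cosh (k * t))⁻¹ • ∫ r in (0:ℝ)..t, A r (cosh (k * r) • Z r)) = _
      rw [add_sub_add_left_eq_sub, ← smul_sub, ← intervalIntegral.integral_sub
        ((hcont Y).intervalIntegrable _ _) ((hcont Z).intervalIntegrable _ _)]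
      simp only [BoundedContinuousFunction.coe_sub, Pi.sub_apply, smul_sub, map_sub]
    rw [e]
    refine (hbound (Y - Z) t).trans_eq ?_
    norm_num
  set Y := hΦ.fixedPoint Φ with hY
  have hfix : Φ Y = Y := hΦ.fixedPoint_isFixedPt
  have hX : ∀ t, cosh (k * t) • Y t = x₀ + ∫ r in (0:ℝ)..t, A r (cosh (k * r) • Y r) := by
    intro t
    have h1 : Y t = (cosh (k * t))⁻¹ • x₀ +
        (cosh (k * t))⁻¹ • ∫ r in (0:ℝ)..t, A r (cosh (k * r) • Y r) := by
      conv_lhs => rw [← hfix]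
      rfl
    rw [h1, ← smul_add, smul_inv_smul₀ (cosh_pos _).ne']
  refine ⟨fun t => cosh (k * t) • Y t, ?_, fun t => ?_⟩
  · simpa using hX 0
  · have e : (fun t => cosh (k * t) • Y t) =
        fun t => x₀ + ∫ r in (0:ℝ)..t, A r (cosh (k * r) • Y r) := funext hX
    rw [e]
    refine HasDerivAt.const_add _ ?_
    have h2 := intervalIntegral.integral_hasDerivAt_right ((hcont Y).intervalIntegrable 0 t)
      (hcont Y).stronglyMeasurable.stronglyMeasurableAtFilter (hcont Y).continuousAt
    rwa [hX t] at h2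

end LinearODE

/-! ### The even solution: existence, symmetry, dependence on the parameter -/

section SecondOrder

open Filter Topology Real

/-- `φ` is the even solution of `φ'' = (W + l) φ` with `φ(0) = 1`, and `ψ = φ'`. -/
structure IsEvenSolution (W : ℝ → ℝ) (l : ℝ) (φ ψ : ℝ → ℝ) : Prop where
  hasDerivAt : ∀ y, HasDerivAt φ (ψ y) y
  hasDerivAt' : ∀ y, HasDerivAt ψ ((W y + l) * φ y) y
  zero : φ 0 = 1
  zero' : ψ 0 = 0

/-- The companion matrix of `φ'' = q φ`. -/
noncomputable def companion (q : ℝ) : ℝ × ℝ →L[ℝ] ℝ × ℝ :=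
  (ContinuousLinearMap.snd ℝ ℝ ℝ).prod (q • ContinuousLinearMap.fst ℝ ℝ ℝ)

theorem companion_apply (q : ℝ) (x : ℝ × ℝ) : companion q x = (x.2, q * x.1) := rfl

theorem norm_companion_le (q : ℝ) : ‖companion q‖ ≤ 1 + |q| := by
  refine ContinuousLinearMap.opNorm_le_bound _ (by positivity) fun x => ?_
  rw [companion_apply, Prod.norm_def, max_le_iff]
  have h1 := norm_fst_le x
  have h2 := norm_snd_le x
  have h0 := norm_nonneg x
  constructor
  · nlinarith [abs_nonneg q]
  · rw [norm_mul, Real.norm_eq_abs]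
    nlinarith [abs_nonneg q]

theorem continuous_companion : Continuous companion := by
  have : companion = fun q : ℝ => companion 0 +
      q • ((0 : ℝ × ℝ →L[ℝ] ℝ).prod (ContinuousLinearMap.fst ℝ ℝ ℝ)) := by
    funext q
    ext <;> simp [companion]
  rw [this]
  fun_prop

theorem IsEvenSolution.hasDerivAt_pair {W : ℝ → ℝ} {l : ℝ} {φ ψ : ℝ → ℝ}
    (h : IsEvenSolution W l φ ψ) (y : ℝ) :
    HasDerivAt (fun y => (φ y, ψ y)) (companion (W y + l) (φ y, ψ y)) y :=
  (h.hasDerivAt y).prodMk (h.hasDerivAt' y)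

theorem exists_isEvenSolution {W : ℝ → ℝ} (hW : Continuous W) {B : ℝ} (hB : ∀ y, |W y| ≤ B)
    (l : ℝ) : ∃ φ ψ, IsEvenSolution W l φ ψ := by
  obtain ⟨X, h0, hX⟩ := exists_solution_linear_ODE (A := fun t => companion (W t + l))
    (K := 1 + (B + |l|)) (continuous_companion.comp (hW.add continuous_const))
    (fun t => (norm_companion_le _).trans (by
      have := abs_add_le (W t) l
      have := hB t
      linarith)) ((1, 0) : ℝ × ℝ)
  refine ⟨fun t => (X t).1, fun t => (X t).2, fun y => ?_, fun y => ?_, by simp [h0], by simp [h0]⟩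
  · exact (hX y).fst
  · exact (hX y).snd

theorem lipschitzWith_companion {W : ℝ → ℝ} {B : ℝ} (hB : ∀ y, |W y| ≤ B) {l Λ : ℝ}
    (hl : |l| ≤ Λ) (t : ℝ) :
    LipschitzWith (1 + (B + Λ)).toNNReal fun x => companion (W t + l) x := by
  refine (companion (W t + l)).lipschitz.weaken ?_
  rw [← NNReal.coe_le_coe, coe_nnnorm]
  refine (norm_companion_le _).trans (le_trans ?_ (Real.le_coe_toNNReal _))
  have := abs_add_le (W t) l
  have := hB t
  linarith

theorem pair_unique {W : ℝ → ℝ} {B : ℝ} (hB : ∀ y, |W y| ≤ B) {l : ℝ} {X Y : ℝ → ℝ × ℝ}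
    (hX : ∀ t, HasDerivAt X (companion (W t + l) (X t)) t)
    (hY : ∀ t, HasDerivAt Y (companion (W t + l) (Y t)) t) {t₀ : ℝ} (h : X t₀ = Y t₀) : X = Y :=
  ODE_solution_unique_univ (s := fun _ => Set.univ)
    (fun t => (lipschitzWith_companion hB le_rfl t).lipschitzOnWith)
    (fun t => ⟨hX t, trivial⟩) (fun t => ⟨hY t, trivial⟩) h

/-- For even W the reflected solution solves the same initial value problem. -/
theorem IsEvenSolution.even {W : ℝ → ℝ} {B : ℝ} (hB : ∀ y, |W y| ≤ B) (hW : ∀ y, W (-y) = W y)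
    {l : ℝ} {φ ψ : ℝ → ℝ} (h : IsEvenSolution W l φ ψ) (y : ℝ) :
    φ (-y) = φ y ∧ ψ (-y) = -ψ y := by
  have := pair_unique hB (X := fun y => (φ (-y), -ψ (-y))) (Y := fun y => (φ y, ψ y)) (l := l)
    (t₀ := 0) (fun t => ?_) h.hasDerivAt_pair (by simp [h.zero'])
  · have h1 := congrFun this y
    simp only [Prod.mk.injEq] at h1
    exact ⟨h1.1, by linarith [h1.2]⟩
  · rw [companion_apply]
    refine HasDerivAt.prodMk ?_ ?_
    · have := (h.hasDerivAt (-t)).comp t (hasDerivAt_neg t)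
      convert! this using 1
      ring
    · have := ((h.hasDerivAt' (-t)).comp t (hasDerivAt_neg t)).neg
      convert! this using 1
      rw [hW]
      ring

/-- A solution has no double zero. -/
theorem IsEvenSolution.not_both_zero {W : ℝ → ℝ} {B : ℝ} (hB : ∀ y, |W y| ≤ B)
    {l : ℝ} {φ ψ : ℝ → ℝ} (h : IsEvenSolution W l φ ψ) {y : ℝ} (h1 : φ y = 0) (h2 : ψ y = 0) :
    False := by
  have := pair_unique hB (Y := fun _ => ((0 : ℝ), (0 : ℝ))) (t₀ := y) h.hasDerivAt_pair (fun t => by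
    rw [companion_apply]
    rw [mul_zero]
    exact hasDerivAt_const t ((0 : ℝ), (0 : ℝ))) (by simp [h1, h2])
  have h0 := congrFun this 0
  simp [h.zero] at h0

/-- Continuous dependence on the parameter, locally uniformly. -/
theorem IsEvenSolution.continuous_dependence {W : ℝ → ℝ} {B : ℝ} (hB : ∀ y, |W y| ≤ B)
    {φ ψ : ℝ → ℝ → ℝ} (h : ∀ l, IsEvenSolution W l (φ l) (ψ l)) (l₀ N : ℝ) {ε : ℝ} (hε : 0 < ε) :
    ∃ δ > 0, ∀ l, |l - l₀| < δ → ∀ y ∈ Set.Icc 0 N,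
      |φ l y - φ l₀ y| < ε ∧ |ψ l y - ψ l₀ y| < ε := by
  have hc : ∀ l, Continuous fun y => (φ l y, ψ l y) := fun l =>
    continuous_iff_continuousAt.2 fun y => ((h l).hasDerivAt_pair y).continuousAt
  obtain ⟨S, hS⟩ := (isCompact_Icc (a := (0:ℝ)) (b := N)).exists_bound_of_continuousOn
    (hc l₀).continuousOn
  -- One Lipschitz constant for all l with |l - l₀| < 1.
  set K : NNReal := (1 + (B + (|l₀| + 1))).toNNReal
  have hlim : Tendsto (fun η => gronwallBound 0 K (0 + η) N) (𝓝 0) (𝓝 0) := by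
    have := (gronwallBound_continuous_ε 0 K N).tendsto 0
    rw [gronwallBound_ε0_δ0] at this
    simpa using this
  obtain ⟨η₀, hη₀, hη⟩ := Metric.eventually_nhds_iff.1 (hlim.eventually (gt_mem_nhds hε))
  have hS1 : 0 < |S| + 1 := by positivity
  refine ⟨min 1 (η₀ / 2 / (|S| + 1)), by positivity, fun l hl y hy => ?_⟩
  have hl1 : |l - l₀| < 1 := hl.trans_le (min_le_left _ _)
  have hl2 : |l - l₀| * (|S| + 1) ≤ η₀ / 2 := by
    rw [← le_div_iff₀ hS1]
    exact hl.le.trans (min_le_right _ _)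
  have hlb : |l| ≤ |l₀| + 1 := by
    have := abs_add_le (l - l₀) l₀
    rw [sub_add_cancel] at this
    linarith
  -- Grönwall: the solution for l₀ solves the equation for l up to the error |l - l₀|·|φ l₀|, at
  -- most η₀/2 on [0, N].
  have key := dist_le_of_approx_trajectories_ODE (δ := 0) (a := 0) (b := N) (εf := 0)
    (εg := η₀ / 2) (K := K) (v := fun t x => companion (W t + l) x)
    (f := fun y => (φ l y, ψ l y)) (g := fun y => (φ l₀ y, ψ l₀ y))
    (fun t => lipschitzWith_companion hB hlb t) (hc l).continuousOn
    (fun t _ => ((h l).hasDerivAt_pair t).hasDerivWithinAt) (fun t _ => by simp)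
    (hc l₀).continuousOn (fun t _ => ((h l₀).hasDerivAt_pair t).hasDerivWithinAt)
    (fun t ht => by
      have h1 := hS t ⟨ht.1, ht.2.le⟩
      have h2 := (norm_fst_le _).trans h1
      rw [companion_apply, companion_apply, Prod.dist_eq, dist_self,
        max_eq_right dist_nonneg, Real.dist_eq]
      have e : (W t + l₀) * φ l₀ t - (W t + l) * φ l₀ t = -((l - l₀) * φ l₀ t) := by ring
      change |(W t + l₀) * φ l₀ t - (W t + l) * φ l₀ t| ≤ _
      rw [e, abs_neg, abs_mul]
      refine le_trans ?_ hl2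
      gcongr
      have h3 : |φ l₀ t| ≤ S := h2
      linarith [le_abs_self S])
    (by simp [(h l).zero, (h l).zero', (h l₀).zero, (h l₀).zero']) y hy
  have hlt : dist (φ l y, ψ l y) (φ l₀ y, ψ l₀ y) < ε := by
    refine key.trans_lt ?_
    have h1 : gronwallBound 0 K (0 + η₀ / 2) N < ε := hη (by
      rw [dist_zero_right, Real.norm_of_nonneg (by positivity)]
      linarith)
    refine lt_of_le_of_lt ?_ h1
    exact gronwallBound_mono le_rfl (by positivity) K.2 (by linarith [hy.2])
  rw [Prod.dist_eq, max_lt_iff] at hlt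
  exact ⟨hlt.1, hlt.2⟩

end SecondOrder

/-! ### The coordinate s and the shape of V -/

section Coordinate

open Filter Topology Real

/-- The coordinate `s = tanh(α⁻¹(y) / 2)`, in which `Q̃` and `V` are polynomials. -/
noncomputable def sCoord (y : ℝ) : ℝ := tanh (alphaIso.symm y / 2)

theorem alphaIso_apply (x : ℝ) : alphaIso x = alpha x := rfl

theorem alphaIso_symm_neg (y : ℝ) : alphaIso.symm (-y) = -alphaIso.symm y := by
  apply alphaIso.injective
  rw [OrderIso.apply_symm_apply, alphaIso_apply]
  have h : alpha (alphaIso.symm y) = y := alphaIso.apply_symm_apply y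
  unfold alpha at h ⊢
  rw [sinh_neg]
  linarith

theorem sCoord_neg (y : ℝ) : sCoord (-y) = -sCoord y := by
  rw [sCoord, sCoord, alphaIso_symm_neg, neg_div, tanh_neg]

theorem sCoord_zero : sCoord 0 = 0 := by
  have := sCoord_neg 0
  rw [neg_zero] at this
  linarith

theorem one_sub_tanh_sq (x : ℝ) : 1 - tanh x ^ 2 = (1 / cosh x) ^ 2 := by
  have h := (cosh_pos x).ne'
  rw [tanh_eq_sinh_div_cosh]
  field_simp
  linarith [cosh_sq_sub_sinh_sq x]

theorem sCoord_sq_lt_one (y : ℝ) : sCoord y ^ 2 < 1 := by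
  have h := one_sub_tanh_sq (alphaIso.symm y / 2)
  have : 0 < (1 / cosh (alphaIso.symm y / 2)) ^ 2 := by
    have := cosh_pos (alphaIso.symm y / 2)
    positivity
  rw [sCoord]
  linarith

theorem Qt_eq (y : ℝ) : Qt y = 3 / 2 * (1 - sCoord y ^ 2) := by
  rw [Qt, Q, sCoord, one_sub_tanh_sq]

theorem V_eq (y : ℝ) : V y = 9 / 4 * (1 - sCoord y ^ 2) ^ 2 * (3 * sCoord y ^ 2 - 1) := by
  rw [V, Qt_eq]
  ring

/-- With x = α⁻¹(y), α'(x) = (2/3)cosh²(x/2) and d tanh(x/2)/dx = (1/2)sech²(x/2), so ds/dy =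
(3/4)sech⁴(x/2). -/
theorem hasDerivAt_sCoord (y : ℝ) :
    HasDerivAt sCoord (3 / 4 * (1 - sCoord y ^ 2) ^ 2) y := by
  set x := alphaIso.symm y with hx
  have hc := cosh_pos (x / 2)
  have hα : HasDerivAt alpha (1 / 3 * (cosh x + 1)) x :=
    (((hasDerivAt_sinh x).add (hasDerivAt_id x)).const_mul (1 / 3))
  have hne : 1 / 3 * (cosh x + 1) ≠ 0 := by
    have := cosh_pos x
    positivity
  have hinv : HasDerivAt alphaIso.symm (1 / 3 * (cosh x + 1))⁻¹ y :=
    HasDerivAt.of_local_left_inverse alphaIso.symm.continuous.continuousAt hα hne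
      (Eventually.of_forall fun z => alphaIso.apply_symm_apply z)
  have htanh : HasDerivAt (fun x => tanh (x / 2)) (1 / 2 * (1 / cosh (x / 2)) ^ 2) x := by
    have e : (fun x => tanh (x / 2)) = fun x => sinh (x / 2) / cosh (x / 2) :=
      funext fun x => tanh_eq_sinh_div_cosh _
    rw [e]
    have h2 : HasDerivAt (fun x : ℝ => x / 2) (1 / 2) x := (hasDerivAt_id x).div_const 2
    have := h2.sinh.div h2.cosh hc.ne'
    convert! this using 1
    field_simp
    linarith [cosh_sq_sub_sinh_sq (x / 2)]
  have := htanh.comp y hinv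
  convert! this using 1
  have hs : 1 - sCoord y ^ 2 = (1 / cosh (x / 2)) ^ 2 := one_sub_tanh_sq _
  have hdouble : cosh x + 1 = 2 * cosh (x / 2) ^ 2 := by
    have := cosh_two_mul (x / 2)
    rw [mul_div_cancel₀ x (two_ne_zero)] at this
    have := cosh_sq_sub_sinh_sq (x / 2)
    linarith
  rw [hs, hdouble]
  field_simp
  norm_num

theorem sCoord_monotone : Monotone sCoord :=
  monotone_of_deriv_nonneg (fun y => (hasDerivAt_sCoord y).differentiableAt) fun y => by
    rw [(hasDerivAt_sCoord y).deriv]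
    positivity

theorem sCoord_nonneg {y : ℝ} (hy : 0 ≤ y) : 0 ≤ sCoord y := by
  rw [← sCoord_zero]
  exact sCoord_monotone hy

theorem sCoord_lt_one (y : ℝ) : sCoord y < 1 := by
  nlinarith [sCoord_sq_lt_one y, sq_nonneg (sCoord y - 1)]

theorem sCoord_sq_le_sq {x y : ℝ} (hx : 0 ≤ x) (hxy : x ≤ y) : sCoord x ^ 2 ≤ sCoord y ^ 2 :=
  pow_le_pow_left₀ (sCoord_nonneg hx) (sCoord_monotone hxy) 2

theorem tendsto_cosh_atTop : Tendsto cosh atTop atTop := by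
  refine tendsto_atTop_mono (fun x => ?_) (tendsto_exp_atTop.const_mul_atTop (r := 1 / 2)
    (by norm_num))
  rw [cosh_eq]
  linarith [exp_pos (-x)]

theorem tendsto_sCoord : Tendsto sCoord atTop (𝓝 1) := by
  have h1 : Tendsto (fun y => cosh (alphaIso.symm y / 2)) atTop atTop :=
    tendsto_cosh_atTop.comp (alphaIso.symm.tendsto_atTop.atTop_div_const (by norm_num))
  have h2 : Tendsto (fun y => 1 - (1 / cosh (alphaIso.symm y / 2)) ^ 2) atTop (𝓝 1) := by
    have := ((tendsto_inv_atTop_zero.comp h1).pow 2).const_sub 1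
    simpa [Function.comp_def] using this
  have h3 : Tendsto (fun y => sCoord y ^ 2) atTop (𝓝 1) := by
    refine h2.congr fun y => ?_
    rw [← one_sub_tanh_sq, sCoord]
    ring
  have h4 := h3.sqrt
  rw [sqrt_one] at h4
  refine h4.congr' ?_
  filter_upwards [eventually_ge_atTop 0] with y hy
  exact sqrt_sq (sCoord_nonneg hy)

/-- Bootstrap: the derivative of s is a polynomial in s. -/
theorem contDiff_sCoord : ContDiff ℝ ∞ sCoord := by
  have hd : deriv sCoord = fun y => 3 / 4 * (1 - sCoord y ^ 2) ^ 2 :=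
    funext fun y => (hasDerivAt_sCoord y).deriv
  have hdiff : Differentiable ℝ sCoord := fun y => (hasDerivAt_sCoord y).differentiableAt
  rw [contDiff_infty]
  intro n
  induction n with
  | zero => exact contDiff_zero.2 hdiff.continuous
  | succ n ih =>
    push_cast
    rw [contDiff_succ_iff_deriv, hd]
    exact ⟨hdiff, by simp, by fun_prop⟩

theorem contDiff_V : ContDiff ℝ ∞ V := by
  have h := contDiff_sCoord
  have : V = fun y => 9 / 4 * (1 - sCoord y ^ 2) ^ 2 * (3 * sCoord y ^ 2 - 1) := funext V_eq
  rw [this]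
  fun_prop

theorem V_neg (y : ℝ) : V (-y) = V y := by
  rw [V_eq, V_eq, sCoord_neg, neg_sq]

theorem V_le (y : ℝ) : V y ≤ 8 / 27 := by
  have h1 := sCoord_sq_lt_one y
  have hQ : 0 ≤ Qt y := by
    rw [Qt_eq]
    linarith
  rw [V]
  -- 8/27 is the maximum of 2q²(1 - q) over q ≥ 0, reached at q = 2/3: 8/27 - 2q²(1 - q) = 2(q -
  -- 2/3)²(q + 1/3).
  nlinarith [mul_nonneg (sq_nonneg (Qt y - 2 / 3)) (by linarith : 0 ≤ Qt y + 1 / 3)]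

theorem neg_le_V (y : ℝ) : -(9 / 4) ≤ V y := by
  have h1 := sCoord_sq_lt_one y
  have h2 := sq_nonneg (sCoord y)
  rw [V_eq]
  set t := sCoord y ^ 2
  nlinarith [mul_nonneg h2 (sq_nonneg (1 - t)), mul_nonneg h2 (sub_nonneg.2 h1.le)]

theorem abs_V_le (y : ℝ) : |V y| ≤ 9 / 4 :=
  abs_le.2 ⟨neg_le_V y, (V_le y).trans (by norm_num)⟩

theorem V_nonneg_of_le {y : ℝ} (h : 1 / 3 ≤ sCoord y ^ 2) : 0 ≤ V y := by
  rw [V_eq]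
  exact mul_nonneg (by positivity) (by linarith)

/-- For s² ≤ 1/3 both (1 - s²)² and 1 - 3s² are nonnegative and decrease in s², so V, minus their
product up to a factor, increases. -/
theorem V_le_V_of_sq_le {x y : ℝ} (h : sCoord x ^ 2 ≤ sCoord y ^ 2) (hy : sCoord y ^ 2 ≤ 1 / 3) :
    V x ≤ V y := by
  rw [V_eq, V_eq]
  set a := sCoord x ^ 2
  set b := sCoord y ^ 2
  have ha : 0 ≤ a := sq_nonneg _
  have h1 : (1 - b) ^ 2 ≤ (1 - a) ^ 2 := pow_le_pow_left₀ (by linarith) (by linarith) 2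
  nlinarith [mul_nonneg (sq_nonneg (1 - a)) (sub_nonneg.2 h),
    mul_nonneg (sub_nonneg.2 h1) (by linarith : 0 ≤ 1 - 3 * b)]

theorem hasDerivAt_V (y : ℝ) : HasDerivAt V
    (27 / 8 * sCoord y * (1 - sCoord y ^ 2) ^ 3 * (5 - 9 * sCoord y ^ 2)) y := by
  have : V = fun y => 9 / 4 * (1 - sCoord y ^ 2) ^ 2 * (3 * sCoord y ^ 2 - 1) := funext V_eq
  rw [this]
  have hs := hasDerivAt_sCoord y
  have hs2 := hs.pow 2
  have := (((hs2.const_sub 1).pow 2).const_mul (9 / 4)).mul ((hs2.const_mul 3).sub_const 1)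
  convert! this using 1
  simp only [Pi.pow_apply, Nat.cast_ofNat]
  ring

end Coordinate

/-! ### Differential inequalities on a half line -/

section Calculus

open Filter Topology Set

theorem monotoneOn_Ici_of_hasDerivAt {f f' : ℝ → ℝ} {a : ℝ} (hd : ∀ x, HasDerivAt f (f' x) x)
    (h : ∀ x, a ≤ x → 0 ≤ f' x) : MonotoneOn f (Ici a) :=
  monotoneOn_of_deriv_nonneg (convex_Ici a)
    (fun x _ => (hd x).continuousAt.continuousWithinAt)
    (fun x _ => (hd x).differentiableAt.differentiableWithinAt)
    (fun x hx => by
      rw [(hd x).deriv]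
      exact h x (interior_subset hx))

theorem monotoneOn_Icc_of_hasDerivAt {f f' : ℝ → ℝ} {a b : ℝ} (hd : ∀ x, HasDerivAt f (f' x) x)
    (h : ∀ x ∈ Icc a b, 0 ≤ f' x) : MonotoneOn f (Icc a b) :=
  monotoneOn_of_deriv_nonneg (convex_Icc a b)
    (fun x _ => (hd x).continuousAt.continuousWithinAt)
    (fun x _ => (hd x).differentiableAt.differentiableWithinAt)
    (fun x hx => by
      rw [(hd x).deriv]
      exact h x (interior_subset hx))

theorem add_mul_le_of_hasDerivAt {f f' : ℝ → ℝ} {a m : ℝ} (hd : ∀ x, HasDerivAt f (f' x) x)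
    (h : ∀ x, a ≤ x → m ≤ f' x) {x : ℝ} (hx : a ≤ x) : f a + m * (x - a) ≤ f x := by
  have := monotoneOn_Ici_of_hasDerivAt (f := fun x => f x - m * (x - a)) (a := a)
    (fun x => (hd x).sub (((hasDerivAt_id x).sub_const a).const_mul m))
    (fun x hx => by simpa using h x hx) self_mem_Ici hx hx
  simp only [sub_self, mul_zero, sub_zero] at this
  linarith

/-- If `f' ≥ k f` with `k ≥ 0` to the right of `a` and `f a ≥ 0`, then `f ≥ f a` there. -/
theorem le_of_hasDerivAt_ge_mul {f f' : ℝ → ℝ} {a k : ℝ} (hk : 0 ≤ k)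
    (hd : ∀ x, HasDerivAt f (f' x) x) (h : ∀ x, a ≤ x → k * f x ≤ f' x) (ha : 0 ≤ f a)
    {x : ℝ} (hx : a ≤ x) : f a ≤ f x := by
  have hE : ∀ x, HasDerivAt (fun x => Real.exp (-k * (x - a))) (Real.exp (-k * (x - a)) * -k) x := by
    intro x
    have := (((hasDerivAt_id x).sub_const a).const_mul (-k)).exp
    simpa using this
  have := monotoneOn_Ici_of_hasDerivAt (f := fun x => Real.exp (-k * (x - a)) * f x) (a := a)
    (fun x => (hE x).mul (hd x)) (fun x hx => by
      have h1 := h x hx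
      have h2 := Real.exp_pos (-k * (x - a))
      nlinarith) self_mem_Ici hx hx
  simp only [sub_self, mul_zero, Real.exp_zero, one_mul] at this
  have h3 : Real.exp (-k * (x - a)) ≤ 1 := Real.exp_le_one_iff.2 (by nlinarith)
  have h4 : 0 ≤ f x := by
    by_contra hcon
    have := mul_neg_of_pos_of_neg (Real.exp_pos (-k * (x - a))) (not_le.1 hcon)
    linarith
  nlinarith

end Calculus

/-! ### Shooting for the ground state -/

section Shooting

open Filter Topology Set

variable {l : ℝ} {φ ψ : ℝ → ℝ}

/-- A solution that is positive and nondecreasing at `a` stays positive if `V + l ≥ 0` after `a`. -/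
theorem IsEvenSolution.pos_of_potential_nonneg (h : IsEvenSolution V l φ ψ) {a : ℝ}
    (hV : ∀ y, a ≤ y → 0 ≤ V y + l) (ha : 0 < φ a) (ha' : 0 ≤ ψ a) {y : ℝ} (hy : a ≤ y) :
    0 < φ y := by
  -- (φφ')' = φ'² + (V + l)φ² ≥ 0, so φφ' stays nonnegative; then φ² is nondecreasing and φ cannot
  -- reach 0.
  have h1 : ∀ x, a ≤ x → 0 ≤ φ x * ψ x := by
    intro x hx
    have := monotoneOn_Ici_of_hasDerivAt (fun x => (h.hasDerivAt x).mul (h.hasDerivAt' x))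
      (a := a) (fun x hx => by
        nlinarith [sq_nonneg (ψ x), mul_nonneg (hV x hx) (sq_nonneg (φ x))]) self_mem_Ici hx hx
    exact (mul_nonneg ha.le ha').trans this
  have h2 : ∀ x, a ≤ x → φ x ≠ 0 := by
    intro x hx h0
    have := monotoneOn_Ici_of_hasDerivAt (fun x => (h.hasDerivAt x).mul (h.hasDerivAt x))
      (a := a) (fun x hx => by nlinarith [h1 x hx]) self_mem_Ici hx hx
    have h3 : φ a * φ a ≤ φ x * φ x := this
    rw [h0] at h3
    nlinarith
  by_contra hcon
  have hc : ContinuousOn φ (Icc a y) := fun x _ => (h.hasDerivAt x).continuousAt.continuousWithinAt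
  obtain ⟨x, hx, hx0⟩ := intermediate_value_Icc' hy hc ⟨not_lt.1 hcon, ha.le⟩
  exact h2 x hx.1 hx0

/-- A zero of a nonnegative solution would be a minimum, hence a double zero. -/
theorem IsEvenSolution.pos_of_nonneg (h : IsEvenSolution V l φ ψ) (h0 : ∀ y, 0 ≤ y → 0 ≤ φ y)
    (y : ℝ) : 0 < φ y := by
  have hnn : ∀ y, 0 ≤ φ y := by
    intro y
    rcases le_total 0 y with hy | hy
    · exact h0 y hy
    · rw [← (h.even abs_V_le V_neg y).1]
      exact h0 _ (by linarith)
  refine lt_of_le_of_ne (hnn y) fun he => ?_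
  have hmin : IsLocalMin φ y := Eventually.of_forall fun x => he ▸ hnn x
  exact h.not_both_zero abs_V_le he.symm (hmin.hasDerivAt_eq_zero (h.hasDerivAt y))

theorem IsEvenSolution.pos_of_large (h : IsEvenSolution V l φ ψ) (hl : 9 / 4 ≤ l) {y : ℝ}
    (hy : 0 ≤ y) : 0 < φ y :=
  h.pos_of_potential_nonneg (fun y _ => by linarith [neg_le_V y]) (by rw [h.zero]; norm_num)
    h.zero'.ge hy

/-- The logarithmic derivative of a positive solution is bounded below by `-C` if
`V + l ≤ C²`. -/
theorem IsEvenSolution.add_mul_nonneg (h : IsEvenSolution V l φ ψ) (hpos : ∀ y, 0 < φ y)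
    {C : ℝ} (hC : 0 ≤ C) (hlC : l + 8 / 27 ≤ C ^ 2) (y : ℝ) : 0 ≤ ψ y + C * φ y := by
  by_contra hcon
  set m := ψ y + C * φ y with hm
  have hm0 : m < 0 := not_le.1 hcon
  -- f = -(ψ + Cφ) satisfies f' ≥ Cf since V + l ≤ C², so it stays above -m > 0.
  have h1 : ∀ x, y ≤ x → ψ x ≤ m := by
    intro x hx
    have := le_of_hasDerivAt_ge_mul (f := fun x => -(ψ x + C * φ x)) hC
      (fun x => ((h.hasDerivAt' x).add ((h.hasDerivAt x).const_mul C)).neg)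
      (fun x _ => by
        nlinarith [hpos x, mul_le_mul_of_nonneg_right
          (by linarith [V_le x] : V x + l ≤ C ^ 2) (hpos x).le]) (by linarith) hx
    have h2 : ψ x + C * φ x ≤ m := by linarith
    nlinarith [hpos x]
  -- With slope at most m < 0, φ would be nonpositive at this point.
  have hx : y ≤ y + φ y / (-m) := by
    have := div_nonneg (hpos y).le (by linarith : 0 ≤ -m)
    linarith
  have h2 := add_mul_le_of_hasDerivAt (f := fun x => -φ x) (fun x => (h.hasDerivAt x).neg)
    (m := -m) (fun x hx => by linarith [h1 x hx]) hx
  rw [add_sub_cancel_left, mul_div_cancel₀ _ (by linarith : -m ≠ 0)] at h2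
  linarith [hpos (y + φ y / (-m))]

/-- The even solution for `l = 1/2` changes sign. -/
theorem IsEvenSolution.exists_neg_of_half (h : IsEvenSolution V (1 / 2) φ ψ) :
    ∃ y, 0 ≤ y ∧ φ y < 0 := by
  by_contra! hcon
  have hpos := h.pos_of_nonneg hcon
  -- The trial function is f = 1 - s², a multiple of Q̃. P(s(y)) is the integral of f'² + (V +
  -- 1/2)f² over [0, y], which is a polynomial in s; P(1) = -2/105 is the form of L + 1/2 on the
  -- half line.
  set P : ℝ → ℝ := fun s => -(7 / 3) * s + 6 * s ^ 3 - 27 / 5 * s ^ 5 + 12 / 7 * s ^ 7 with hP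
  have hPd : ∀ s, HasDerivAt P (-(7 / 3) + 18 * s ^ 2 - 27 * s ^ 4 + 12 * s ^ 6) s := by
    intro s
    have := ((((hasDerivAt_id s).const_mul (-(7 / 3 : ℝ))).add
      ((hasDerivAt_pow 3 s).const_mul 6)).sub ((hasDerivAt_pow 5 s).const_mul (27 / 5))).add
      ((hasDerivAt_pow 7 s).const_mul (12 / 7))
    convert! this using 1
    norm_num
    ring
  -- Jacobi's identity: with w = ψ/φ and w' = V + 1/2 - w², one has f'² + (V + 1/2)f² - (wf²)' = (f'
  -- - wf)².
  have hd : ∀ y, HasDerivAt (fun y => P (sCoord y) - ψ y / φ y * (1 - sCoord y ^ 2) ^ 2)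
      ((-2 * sCoord y * (3 / 4 * (1 - sCoord y ^ 2) ^ 2) -
        ψ y / φ y * (1 - sCoord y ^ 2)) ^ 2) y := by
    intro y
    have hs := hasDerivAt_sCoord y
    have h1 := (hPd (sCoord y)).comp y hs
    have h2 := (h.hasDerivAt' y).div (h.hasDerivAt y) (hpos y).ne'
    have h3 := ((hs.pow 2).const_sub 1).pow 2
    have := h1.sub (h2.mul h3)
    convert! this using 1
    have hne := (hpos y).ne'
    rw [V_eq]
    simp only [Pi.pow_apply, Pi.div_apply, Nat.cast_ofNat]
    field_simp
    ring
  have hmono : ∀ y, 0 ≤ y → 0 ≤ P (sCoord y) - ψ y / φ y * (1 - sCoord y ^ 2) ^ 2 := by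
    intro y hy
    have := monotoneOn_Ici_of_hasDerivAt hd (a := 0) (fun x _ => sq_nonneg _) self_mem_Ici hy hy
    refine le_trans (le_of_eq ?_) this
    simp [hP, sCoord_zero, h.zero']
  -- Since 1/2 + 8/27 ≤ 1, w ≥ -1. So the term wf² disappears at infinity, leaving P(1) ≥ 0, a
  -- contradiction.
  have hbound : ∀ y, 0 ≤ y → 0 ≤ P (sCoord y) + 1 * (1 - sCoord y ^ 2) ^ 2 := by
    intro y hy
    have h1 := h.add_mul_nonneg hpos (C := 1) (by norm_num) (by norm_num) y
    have h2 : -1 ≤ ψ y / φ y := by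
      rw [le_div_iff₀ (hpos y)]
      linarith
    nlinarith [hmono y hy, sq_nonneg (1 - sCoord y ^ 2)]
  have hlim : Tendsto (fun y => P (sCoord y) + 1 * (1 - sCoord y ^ 2) ^ 2) atTop
      (𝓝 (P 1 + 1 * (1 - 1 ^ 2) ^ 2)) := by
    have hc : Continuous fun s : ℝ => P s + 1 * (1 - s ^ 2) ^ 2 := by
      rw [hP]
      fun_prop
    exact (hc.tendsto 1).comp tendsto_sCoord
  have := ge_of_tendsto hlim (eventually_atTop.2 ⟨0, hbound⟩)
  rw [hP] at this
  norm_num at this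

/-- There is a parameter for which the even solution is positive and decreasing on the half
line. -/
theorem exists_decreasing_evenSolution :
    ∃ l φ ψ, 1 / 2 ≤ l ∧ IsEvenSolution V l φ ψ ∧ (∀ y, 0 < φ y) ∧ ∀ y, 0 ≤ y → ψ y ≤ 0 := by
  choose φ ψ h using fun l => exists_isEvenSolution contDiff_V.continuous abs_V_le l
  set A : Set ℝ := {l | ∃ y, 0 ≤ y ∧ φ l y < 0} with hA
  have hmem : (1 / 2 : ℝ) ∈ A := (h (1 / 2)).exists_neg_of_half
  have hbdd : BddAbove A := by
    refine ⟨9 / 4, fun l hl => ?_⟩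
    obtain ⟨y, hy, hneg⟩ := hl
    by_contra hcon
    linarith [(h l).pos_of_large (not_le.1 hcon).le hy]
  set l₀ := sSup A with hl₀
  have hl0 : 1 / 2 ≤ l₀ := le_csSup hbdd hmem
  -- A negative value persists for slightly larger l, which would then belong to A beyond its
  -- supremum.
  have hnn : ∀ y, 0 ≤ y → 0 ≤ φ l₀ y := by
    intro y hy
    by_contra hcon
    obtain ⟨δ, hδ, hc⟩ := IsEvenSolution.continuous_dependence abs_V_le h l₀ y
      (ε := -φ l₀ y) (by linarith)
    have h1 := (hc (l₀ + δ / 2) (by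
      rw [add_sub_cancel_left, abs_of_pos (by positivity)]
      linarith) y ⟨hy, le_rfl⟩).1
    have h2 : l₀ + δ / 2 ∈ A := ⟨y, hy, by linarith [(abs_lt.1 h1).2]⟩
    linarith [le_csSup hbdd h2]
  have hpos := (h l₀).pos_of_nonneg hnn
  refine ⟨l₀, φ l₀, ψ l₀, hl0, h l₀, hpos, fun y hy => ?_⟩
  by_contra hcon
  have hψ : 0 < ψ l₀ y := not_le.1 hcon
  -- Otherwise s² < 1/3 at y, and V + l₀ ≤ 0 on all of [0, y] since V increases there; ψ would be
  -- nonincreasing from ψ(0) = 0.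
  have hVy : 0 < V y + l₀ := by
    by_contra hV
    have hs : sCoord y ^ 2 < 1 / 3 := by
      by_contra hs
      linarith [V_nonneg_of_le (not_lt.1 hs)]
    have := monotoneOn_Icc_of_hasDerivAt (f := fun x => -ψ l₀ x) (a := 0) (b := y)
      (fun x => ((h l₀).hasDerivAt' x).neg) (fun x hx => by
        have h1 := V_le_V_of_sq_le (sCoord_sq_le_sq hx.1 hx.2) hs.le
        nlinarith [hpos x, mul_nonneg (by linarith : 0 ≤ -(V x + l₀)) (hpos x).le])
      (left_mem_Icc.2 hy) (right_mem_Icc.2 hy) hy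
    have h0 := (h l₀).zero'
    linarith
  have hcont : ContinuousOn (φ l₀) (Icc 0 y) :=
    fun x _ => ((h l₀).hasDerivAt x).continuousAt.continuousWithinAt
  obtain ⟨x₀, hx₀, hmin⟩ := isCompact_Icc.exists_isMinOn (nonempty_Icc.2 hy) hcont
  obtain ⟨δ, hδ, hc⟩ := IsEvenSolution.continuous_dependence abs_V_le h l₀ y
    (ε := min (φ l₀ x₀) (ψ l₀ y)) (lt_min (hpos x₀) hψ)
  -- Take l in A so close to l₀ that φ l > 0 on [0, y], ψ l y > 0, V y + l > 0 and l > 0. Then V + l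
  -- ≥ 0 beyond y, so φ l stays positive there, contradicting membership in A.
  obtain ⟨l, hl, hlt⟩ := exists_lt_of_lt_csSup ⟨_, hmem⟩
    (show l₀ - min (min δ (V y + l₀)) (1 / 2) < sSup A by
      have : 0 < min (min δ (V y + l₀)) (1 / 2) := lt_min (lt_min hδ hVy) (by norm_num)
      linarith)
  have hle : l ≤ l₀ := le_csSup hbdd hl
  have m1 := min_le_left (min δ (V y + l₀)) (1 / 2)
  have m2 := min_le_right (min δ (V y + l₀)) (1 / 2)
  have m3 := min_le_left δ (V y + l₀)
  have m4 := min_le_right δ (V y + l₀)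
  have hclose := hc l (by rw [abs_lt]; constructor <;> linarith)
  have hposI : ∀ x ∈ Icc 0 y, 0 < φ l x := by
    intro x hx
    have h1 := (abs_lt.1 (hclose x hx).1).1
    have h2 : φ l₀ x₀ ≤ φ l₀ x := hmin hx
    linarith [min_le_left (φ l₀ x₀) (ψ l₀ y)]
  have hψl : 0 < ψ l y := by
    have h1 := (abs_lt.1 (hclose y ⟨hy, le_rfl⟩).2).1
    linarith [min_le_right (φ l₀ x₀) (ψ l₀ y)]
  obtain ⟨z, hz, hzneg⟩ := hl
  rcases le_total z y with hzy | hzy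
  · linarith [hposI z ⟨hz, hzy⟩]
  · have := (h l).pos_of_potential_nonneg (a := y) (fun x hx => by
      rcases le_total (sCoord x ^ 2) (1 / 3) with hs | hs
      · linarith [V_le_V_of_sq_le (sCoord_sq_le_sq hy hx) hs]
      · linarith [V_nonneg_of_le hs]) (hposI y ⟨hy, le_rfl⟩) hψl.le hzy
    linarith

end Shooting

/-! ### Decay of the ground state and nonnegativity of the partner potential -/

section GroundState

open Filter Topology Set

variable {l : ℝ} {φ ψ : ℝ → ℝ}

/-- In the region V ≥ 0, q = ψ + φ/2 satisfies q' ≥ q/2. If q were positive at y, it would stay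
above its value there, φ would be bounded below, and ψ would grow linearly, against ψ ≤ 0. -/
theorem IsEvenSolution.add_half_mul_nonpos (h : IsEvenSolution V l φ ψ) (hl : 1 / 2 ≤ l)
    (hpos : ∀ y, 0 < φ y) (hdec : ∀ y, 0 ≤ y → ψ y ≤ 0) {y : ℝ} (hy : 0 ≤ y)
    (hs : 1 / 3 ≤ sCoord y ^ 2) : ψ y + 1 / 2 * φ y ≤ 0 := by
  by_contra hcon
  set q := ψ y + 1 / 2 * φ y with hq
  have hq0 : 0 < q := not_le.1 hcon
  have hV : ∀ x, y ≤ x → 0 ≤ V x := fun x hx => V_nonneg_of_le (hs.trans (sCoord_sq_le_sq hy hx))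
  have h1 : ∀ x, y ≤ x → 1 / 2 * q ≤ (V x + l) * φ x := by
    intro x hx
    have h2 := le_of_hasDerivAt_ge_mul (f := fun x => ψ x + 1 / 2 * φ x) (k := 1 / 2) (by norm_num)
      (fun x => (h.hasDerivAt' x).add ((h.hasDerivAt x).const_mul (1 / 2)))
      (fun x hx => by nlinarith [hpos x, mul_nonneg (hV x hx) (hpos x).le]) hq0.le hx
    have h3 := hdec x (hy.trans hx)
    have h4 : q ≤ 1 / 2 * φ x := by linarith
    nlinarith [hpos x, mul_nonneg (hV x hx) (hpos x).le]
  -- The linear lower bound for ψ equals 1 at this point.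
  have hx : y ≤ y + (1 - ψ y) / (1 / 2 * q) := by
    have := div_nonneg (by linarith [hdec y hy] : 0 ≤ 1 - ψ y) (by linarith : 0 ≤ 1 / 2 * q)
    linarith
  have h2 := add_mul_le_of_hasDerivAt h.hasDerivAt' h1 hx
  rw [add_sub_cancel_left, mul_div_cancel₀ _ (by linarith : 1 / 2 * q ≠ 0)] at h2
  linarith [hdec _ (hy.trans hx)]

/-- (15/4)s + ψ/φ vanishes at 0 and is nondecreasing while s² ≤ 1/3, by the Riccati equation and
(ψ/φ)² ≤ l + 8/27. The slope 15/4 is the largest that the inequality `key` in `partner_nonneg`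
tolerates as s → 0. -/
theorem IsEvenSolution.add_sCoord_mul_nonneg (h : IsEvenSolution V l φ ψ) (hl : 1 / 2 ≤ l)
    (hpos : ∀ y, 0 < φ y) (hdec : ∀ y, 0 ≤ y → ψ y ≤ 0) {y : ℝ} (hy : 0 ≤ y)
    (hs : sCoord y ^ 2 ≤ 1 / 3) : 0 ≤ ψ y + 15 / 4 * sCoord y * φ y := by
  have hC2 : Real.sqrt (l + 8 / 27) ^ 2 = l + 8 / 27 := Real.sq_sqrt (by linarith)
  have hmono := monotoneOn_Icc_of_hasDerivAt (f := fun y => 15 / 4 * sCoord y + ψ y / φ y)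
    (a := 0) (b := y) (fun x => ((hasDerivAt_sCoord x).const_mul (15 / 4)).add
      ((h.hasDerivAt' x).div (h.hasDerivAt x) (hpos x).ne')) (fun x hx => by
      have hp := hpos x
      have h1 := h.add_mul_nonneg hpos (Real.sqrt_nonneg (l + 8 / 27)) hC2.ge x
      have h2 := hdec x hx.1
      have hw : (ψ x / φ x) ^ 2 ≤ l + 8 / 27 := by
        rw [← hC2, div_pow, div_le_iff₀ (by positivity), ← mul_pow]
        have h3 := mul_nonneg (Real.sqrt_nonneg (l + 8 / 27)) hp.le
        exact sq_le_sq' (by linarith) (by linarith)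
      have e : ((V x + l) * φ x * φ x - ψ x * ψ x) / φ x ^ 2 = V x + l - (ψ x / φ x) ^ 2 := by
        field_simp
      rw [e]
      have ht : sCoord x ^ 2 ≤ 1 / 3 := (sCoord_sq_le_sq hx.1 hx.2).trans hs
      have ht0 := sq_nonneg (sCoord x)
      rw [V_eq]
      set t := sCoord x ^ 2
      -- The terms in l cancel; what remains of the derivative bound is 45/16·(1 - t)² + V - 8/27
      -- with t = s².
      have h4 : 8 / 27 ≤ (1 - t) ^ 2 * (9 + 108 * t) / 16 := by
        nlinarith [mul_nonneg ht0 (sub_nonneg.2 ht), mul_nonneg ht0 (mul_nonneg ht0 ht0)]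
      nlinarith) (left_mem_Icc.2 hy) (right_mem_Icc.2 hy) hy
  simp only [sCoord_zero, h.zero'] at hmono
  have h0 : 0 ≤ 15 / 4 * sCoord y + ψ y / φ y := by simpa using hmono
  have h1 := mul_nonneg h0 (hpos y).le
  rw [add_mul, div_mul_cancel₀ _ (hpos y).ne'] at h1
  linarith

/-- Where ψ ≤ -φ/2, eˣφ² is nonincreasing. The resulting exponential decay is weakened to 1/(1 +
y²), enough for φ ∈ L² and φ → 0. -/
theorem IsEvenSolution.exists_decay (h : IsEvenSolution V l φ ψ) (hl : 1 / 2 ≤ l)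
    (hpos : ∀ y, 0 < φ y) (hdec : ∀ y, 0 ≤ y → ψ y ≤ 0) :
    ∃ K, 0 ≤ K ∧ ∀ y, φ y ^ 2 ≤ K * (1 + y ^ 2)⁻¹ := by
  have hlim : ∀ᶠ y in atTop, 1 / 3 ≤ sCoord y ^ 2 := by
    have := tendsto_sCoord.pow 2
    exact this.eventually_const_le (by norm_num)
  obtain ⟨a, ha, ha0⟩ := (hlim.and (eventually_ge_atTop 0)).exists
  have h1 : ∀ x, 0 ≤ x → φ x ^ 2 ≤ 1 := by
    intro x hx
    have := monotoneOn_Ici_of_hasDerivAt (f := fun x => -φ x) (a := 0)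
      (fun x => (h.hasDerivAt x).neg) (fun x hx => by linarith [hdec x hx]) self_mem_Ici hx hx
    have h0 := h.zero
    have h3 : φ x ≤ 1 := by linarith
    exact pow_le_one₀ (hpos x).le h3
  have h2 : ∀ x, 0 ≤ x → Real.exp x * φ x ^ 2 ≤ Real.exp a := by
    intro x hx
    rcases le_total x a with hxa | hxa
    · exact (mul_le_of_le_one_right (Real.exp_pos x).le (h1 x hx)).trans (Real.exp_le_exp.2 hxa)
    · have := monotoneOn_Ici_of_hasDerivAt (f := fun x => -(Real.exp x * φ x ^ 2)) (a := a)
        (fun x => ((Real.hasDerivAt_exp x).mul ((h.hasDerivAt x).pow 2)).neg) (fun x hx => by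
          have h3 := h.add_half_mul_nonpos hl hpos hdec (ha0.trans hx)
            (ha.trans (sCoord_sq_le_sq ha0 hx))
          have h4 := mul_nonneg (Real.exp_pos x).le (mul_nonneg (hpos x).le
            (by linarith : 0 ≤ -(ψ x + 1 / 2 * φ x)))
          simp only [Pi.pow_apply, Nat.cast_ofNat, Nat.reduceSub, pow_one]
          linarith) self_mem_Ici hxa hxa
      have h5 := mul_le_of_le_one_right (Real.exp_pos a).le (h1 a ha0)
      linarith
  have h3 : ∀ x, 0 ≤ x → φ x ^ 2 ≤ 2 * Real.exp a * (1 + x ^ 2)⁻¹ := by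
    intro x hx
    rw [← div_eq_mul_inv, le_div_iff₀ (by positivity)]
    have h4 := Real.quadratic_le_exp_of_nonneg hx
    have h5 := h2 x hx
    have h6 := sq_nonneg (φ x)
    nlinarith [mul_le_mul_of_nonneg_left h4 h6, mul_nonneg h6 hx]
  refine ⟨2 * Real.exp a, by positivity, fun y => ?_⟩
  rcases le_total 0 y with hy | hy
  · exact h3 y hy
  · have := h3 (-y) (by linarith)
    rwa [(h.even abs_V_le V_neg y).1, neg_sq] at this

/-- The expression Z is φ²V₀/2 when μ² = l. The function Z is nonincreasing on [0,∞) and at least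
-(l + 4/27)φ², which tends to 0. -/
theorem IsEvenSolution.partner_nonneg (h : IsEvenSolution V l φ ψ) (hl : 1 / 2 ≤ l)
    (hpos : ∀ y, 0 < φ y) (hdec : ∀ y, 0 ≤ y → ψ y ≤ 0) (y : ℝ) :
    0 ≤ ψ y ^ 2 - (l + V y / 2) * φ y ^ 2 := by
  wlog hy : 0 ≤ y generalizing y
  · have := this (-y) (by linarith)
    obtain ⟨h1, h2⟩ := h.even abs_V_le V_neg y
    rwa [h1, h2, neg_sq, V_neg] at this
  by_contra hcon
  set Z : ℝ → ℝ := fun y => ψ y ^ 2 - (l + V y / 2) * φ y ^ 2 with hZ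
  have hd : ∀ x, HasDerivAt (fun x => -Z x) (-(φ x * (V x * ψ x -
      27 / 16 * sCoord x * (1 - sCoord x ^ 2) ^ 3 * (5 - 9 * sCoord x ^ 2) * φ x))) x := by
    intro x
    have := (((h.hasDerivAt' x).pow 2).sub ((((hasDerivAt_V x).div_const 2).const_add l).mul
      ((h.hasDerivAt x).pow 2))).neg
    convert! this using 1
    simp only [Pi.pow_apply, Nat.cast_ofNat]
    ring
  have hsign : ∀ x, y ≤ x → 0 ≤ -(φ x * (V x * ψ x -
      27 / 16 * sCoord x * (1 - sCoord x ^ 2) ^ 3 * (5 - 9 * sCoord x ^ 2) * φ x)) := by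
    intro x hx
    have hx0 := hy.trans hx
    have hp := hpos x
    have hψ := hdec x hx0
    have hs0 := sCoord_nonneg hx0
    have hs1 := sCoord_lt_one x
    -- This is Vψ ≤ V'φ/2 after division by (9/16)(1 - s²)². For s² ≤ 1/3, V ≤ 0 and the lower bound
    -- -(15/4)s for ψ/φ applies; for 1/3 ≤ s² ≤ 5/9, V and V' are nonnegative and ψ ≤ 0 suffices;
    -- for s² ≥ 5/9, V' ≤ 0 and ψ/φ ≤ -1/2 compensates.
    have key : 4 * ψ x * (3 * sCoord x ^ 2 - 1) ≤
        3 * sCoord x * (1 - sCoord x ^ 2) * (5 - 9 * sCoord x ^ 2) * φ x := by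
      have ht1 := sCoord_sq_lt_one x
      have ht0 := sq_nonneg (sCoord x)
      rcases le_total (sCoord x ^ 2) (1 / 3) with ht | ht
      · have h1 := h.add_sCoord_mul_nonneg hl hpos hdec hx0 ht
        have h2 := mul_nonneg h1 (by linarith : 0 ≤ 4 * (1 - 3 * sCoord x ^ 2))
        have h3 : 0 ≤ 3 * (sCoord x * φ x) * (sCoord x ^ 2 + 9 * (sCoord x ^ 2) ^ 2) := by positivity
        linarith
      · rcases le_total (sCoord x ^ 2) (5 / 9) with ht' | ht'
        · have h2 := mul_nonneg (neg_nonneg.2 hψ) (by linarith : 0 ≤ 4 * (3 * sCoord x ^ 2 - 1))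
          have h3 : 0 ≤ 3 * sCoord x * (1 - sCoord x ^ 2) * (5 - 9 * sCoord x ^ 2) * φ x :=
            mul_nonneg (mul_nonneg (mul_nonneg (by linarith) (by linarith)) (by linarith)) hp.le
          linarith
        · have h1 := h.add_half_mul_nonpos hl hpos hdec hx0 ht
          have h2 := mul_nonneg (neg_nonneg.2 h1) (by linarith : 0 ≤ 4 * (3 * sCoord x ^ 2 - 1))
          have h3 : 3 * sCoord x * ((1 - sCoord x ^ 2) * (9 * sCoord x ^ 2 - 5)) ≤
              3 * 1 * ((1 - sCoord x ^ 2) * (9 * sCoord x ^ 2 - 5)) := by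
            have := mul_nonneg (sub_nonneg.2 ht1.le) (by linarith : 0 ≤ 9 * sCoord x ^ 2 - 5)
            nlinarith
          have h4 : 3 * 1 * ((1 - sCoord x ^ 2) * (9 * sCoord x ^ 2 - 5)) ≤
              2 * (3 * sCoord x ^ 2 - 1) := by
            -- With t = s² the difference of the two sides is 27(t - 2/3)² + 1.
            nlinarith [sq_nonneg (sCoord x ^ 2 - 2 / 3)]
          have h5 := mul_le_mul_of_nonneg_right (h3.trans h4) hp.le
          linarith
    have h6 : V x * ψ x - 27 / 16 * sCoord x * (1 - sCoord x ^ 2) ^ 3 *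
        (5 - 9 * sCoord x ^ 2) * φ x = 9 / 16 * (1 - sCoord x ^ 2) ^ 2 *
        (4 * ψ x * (3 * sCoord x ^ 2 - 1) -
          3 * sCoord x * (1 - sCoord x ^ 2) * (5 - 9 * sCoord x ^ 2) * φ x) := by
      rw [V_eq]
      ring
    rw [h6]
    have h7 := mul_nonneg hp.le (mul_nonneg (by positivity : 0 ≤ 9 / 16 * (1 - sCoord x ^ 2) ^ 2)
      (sub_nonneg.2 key))
    linarith
  have hle : ∀ x, y ≤ x → Z x ≤ Z y := by
    intro x hx
    have := monotoneOn_Ici_of_hasDerivAt hd hsign self_mem_Ici hx hx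
    simpa using this
  obtain ⟨K, hK0, hK⟩ := h.exists_decay hl hpos hdec
  have hlow : ∀ x, y ≤ x → -((l + 4 / 27) * (K * (1 + x ^ 2)⁻¹)) ≤ Z y := by
    intro x hx
    refine le_trans ?_ (hle x hx)
    have h1 : (l + V x / 2) * φ x ^ 2 ≤ (l + 4 / 27) * (K * (1 + x ^ 2)⁻¹) :=
      mul_le_mul (by linarith [V_le x]) (hK x) (sq_nonneg _) (by linarith)
    have h2 := sq_nonneg (ψ x)
    simp only [hZ]
    linarith
  have hlim : Tendsto (fun x : ℝ => -((l + 4 / 27) * (K * (1 + x ^ 2)⁻¹))) atTop (𝓝 0) := by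
    have h1 : Tendsto (fun x : ℝ => (1 + x ^ 2)⁻¹) atTop (𝓝 0) :=
      tendsto_inv_atTop_zero.comp (tendsto_atTop_add_const_left _ _ (tendsto_pow_atTop two_ne_zero))
    have := ((h1.const_mul K).const_mul (l + 4 / 27)).neg
    simpa using this
  have := le_of_tendsto hlim (eventually_atTop.2 ⟨y, hlow⟩)
  exact hcon this

theorem IsEvenSolution.contDiff (h : IsEvenSolution V l φ ψ) : ContDiff ℝ ∞ φ ∧ ContDiff ℝ ∞ ψ := by
  have hV := contDiff_V
  have hφd : deriv φ = ψ := funext fun y => (h.hasDerivAt y).deriv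
  have hψd : deriv ψ = fun y => (V y + l) * φ y := funext fun y => (h.hasDerivAt' y).deriv
  have hφ : Differentiable ℝ φ := fun y => (h.hasDerivAt y).differentiableAt
  have hψ : Differentiable ℝ ψ := fun y => (h.hasDerivAt' y).differentiableAt
  suffices H : ∀ n : ℕ, ContDiff ℝ n φ ∧ ContDiff ℝ n ψ from
    ⟨contDiff_infty.2 fun n => (H n).1, contDiff_infty.2 fun n => (H n).2⟩
  intro n
  induction n with
  | zero => exact ⟨contDiff_zero.2 hφ.continuous, contDiff_zero.2 hψ.continuous⟩
  | succ n ih =>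
    push_cast
    rw [contDiff_succ_iff_deriv, contDiff_succ_iff_deriv, hφd, hψd]
    have hVn : ContDiff ℝ n V := contDiff_infty.1 hV n
    exact ⟨⟨hφ, by simp, ih.2⟩, hψ, by simp, (hVn.add contDiff_const).mul ih.1⟩

/-- The ground state: a positive decaying solution with all the properties used below. -/
theorem exists_groundState :
    ∃ (μ : ℝ) (φ : ℝ → ℝ), 0 < μ ∧ ContDiff ℝ 2 φ ∧ (∀ x, 0 < φ x) ∧
      MemLp (fun x => (φ x : ℂ)) 2 volume ∧ (∃ C, ∀ x, |logDerivative φ x| ≤ C) ∧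
      ContDiff ℝ ∞ (logDerivative φ) ∧
      (∀ x, deriv (logDerivative φ) x = V x + μ ^ 2 - logDerivative φ x ^ 2) ∧
      ∀ x, 0 ≤ V0 μ φ x := by
  obtain ⟨l, φ, ψ, hl, h, hpos, hdec⟩ := exists_decreasing_evenSolution
  have hφd : deriv φ = ψ := funext fun y => (h.hasDerivAt y).deriv
  obtain ⟨hφs, hψs⟩ := h.contDiff
  have hμ : Real.sqrt l ^ 2 = l := Real.sq_sqrt (by linarith)
  have hlog : logDerivative φ = fun x => ψ x / φ x := by
    funext x
    rw [logDerivative, hφd]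
  refine ⟨Real.sqrt l, φ, Real.sqrt_pos.2 (by linarith), contDiff_infty.1 hφs 2, hpos,
    ?_, ?_, ?_, ?_, ?_⟩
  · obtain ⟨K, hK0, hK⟩ := h.exists_decay hl hpos hdec
    have hc : Continuous fun x => (φ x : ℂ) := Complex.continuous_ofReal.comp hφs.continuous
    rw [memLp_two_iff_integrable_sq_norm hc.aestronglyMeasurable]
    refine Integrable.mono' (integrable_inv_one_add_sq.const_mul K)
      (hc.norm.pow 2).aestronglyMeasurable (ae_of_all _ fun x => ?_)
    rw [Real.norm_of_nonneg (sq_nonneg _), Complex.norm_real, Real.norm_eq_abs, sq_abs]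
    exact hK x
  · have hC2 : Real.sqrt (l + 8 / 27) ^ 2 = l + 8 / 27 := Real.sq_sqrt (by linarith)
    have hb : ∀ x, 0 ≤ x → |ψ x / φ x| ≤ Real.sqrt (l + 8 / 27) := by
      intro x hx
      have h1 := h.add_mul_nonneg hpos (Real.sqrt_nonneg (l + 8 / 27)) hC2.ge x
      rw [abs_div, abs_of_pos (hpos x), abs_of_nonpos (hdec x hx), div_le_iff₀ (hpos x)]
      linarith
    refine ⟨Real.sqrt (l + 8 / 27), fun x => ?_⟩
    rw [hlog]
    rcases le_total 0 x with hx | hx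
    · exact hb x hx
    · have := hb (-x) (by linarith)
      rwa [(h.even abs_V_le V_neg x).1, (h.even abs_V_le V_neg x).2, neg_div, abs_neg] at this
  · rw [hlog]
    exact hψs.div hφs fun x => (hpos x).ne'
  · intro x
    have hne := (hpos x).ne'
    rw [hlog, hμ, ((h.hasDerivAt' x).fun_div (h.hasDerivAt x) hne).deriv]
    field_simp
  · intro x
    have h1 := h.partner_nonneg hl hpos hdec x
    have hp := hpos x
    rw [V0, hφd, hμ]
    have e : 2 * (ψ x / φ x) ^ 2 - 2 * l - V x =
        2 * ((ψ x ^ 2 - (l + V x / 2) * φ x ^ 2) / φ x ^ 2) := by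
      field_simp
      ring
    rw [e]
    positivity

end GroundState

/-! ### Normalization; φ'/φ and V₀ do not see the scaling -/

section Normalization

variable {φ : ℝ → ℝ} {c : ℝ}

theorem deriv_const_mul_div (hφ : Differentiable ℝ φ) (hc : c ≠ 0) (x : ℝ) :
    deriv (fun x => c * φ x) x / (c * φ x) = deriv φ x / φ x := by
  rw [((hφ x).hasDerivAt.const_mul c).deriv, mul_div_mul_left _ _ hc]

theorem logDerivative_const_mul (hφ : Differentiable ℝ φ) (hc : c ≠ 0) :
    logDerivative (fun x => c * φ x) = logDerivative φ :=
  funext fun x => deriv_const_mul_div hφ hc x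

theorem V0_const_mul (hφ : Differentiable ℝ φ) (hc : c ≠ 0) (μ : ℝ) :
    V0 μ (fun x => c * φ x) = V0 μ φ := by
  funext x
  rw [V0, V0, deriv_const_mul_div hφ hc x]

/-- The ground state, normalized in `L²`. -/
theorem exists_normalized_groundState :
    ∃ (μ : ℝ) (φ : ℝ → ℝ), 0 < μ ∧ ContDiff ℝ 2 φ ∧ (∀ x, 0 < φ x) ∧
      (∃ hφ : MemLp (fun x => (φ x : ℂ)) 2 volume, ‖hφ.toLp‖ = 1) ∧
      (∃ C, ∀ x, |logDerivative φ x| ≤ C) ∧ ContDiff ℝ ∞ (logDerivative φ) ∧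
      (∀ x, deriv (logDerivative φ) x = V x + μ ^ 2 - logDerivative φ x ^ 2) ∧
      ∀ x, 0 ≤ V0 μ φ x := by
  obtain ⟨μ, φ, hμ, h2, hpos, hL, hC, hs, hR, hV⟩ := exists_groundState
  have hd : Differentiable ℝ φ := h2.differentiable (by simp)
  have hn : hL.toLp ≠ 0 := by
    intro h0
    have h1 := hL.coeFn_toLp
    rw [h0] at h1
    have h3 : ∀ᵐ x : ℝ, False := by
      filter_upwards [h1, Lp.coeFn_zero ℂ 2 (volume : Measure ℝ)] with x hx hx'
      rw [hx', Pi.zero_apply] at hx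
      exact (hpos x).ne' (Complex.ofReal_eq_zero.1 hx.symm)
    exact h3.exists.choose_spec
  set c : ℝ := ‖hL.toLp‖⁻¹ with hc
  have hcp : 0 < c := inv_pos.2 (norm_pos_iff.2 hn)
  have e : (fun x => ((c * φ x : ℝ) : ℂ)) = (c : ℂ) • fun x => (φ x : ℂ) := by
    funext x
    simp
  have hm : MemLp (fun x => ((c * φ x : ℝ) : ℂ)) 2 volume := by
    rw [e]
    exact hL.const_smul _
  refine ⟨μ, fun x => c * φ x, hμ, contDiff_const.mul h2, fun x => mul_pos hcp (hpos x),
    ⟨hm, ?_⟩, ?_⟩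
  · have h4 : hm.toLp = (c : ℂ) • hL.toLp := by
      rw [← MemLp.toLp_const_smul]
      exact MemLp.toLp_congr _ _ (Filter.EventuallyEq.of_eq e)
    rw [h4, norm_smul, Complex.norm_real, Real.norm_of_nonneg hcp.le, hc,
      inv_mul_cancel₀ (norm_ne_zero_iff.2 hn)]
  · rw [logDerivative_const_mul hd hcp.ne', V0_const_mul hd hcp.ne']
    exact ⟨hC, hs, hR, hV⟩

end Normalization

end KinkSpectrum

/-! ### Assembly -/

theorem mainTheorem3 :
    ∃ μ₀ : ℝ, 0 < μ₀ ∧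
      {r : ℝ | r < 0 ∧ (r : ℂ) ∈ pointSpectrum L} = {-μ₀ ^ 2} ∧
      Module.finrank ℂ (eigenspace L (-(μ₀ : ℂ) ^ 2)) = 1 ∧
      ∃ φ₀ : ℝ → ℝ, ContDiff ℝ 2 φ₀ ∧ (∀ x, 0 < φ₀ x) ∧
        (∃ hφ : MemLp (fun x => (φ₀ x : ℂ)) 2 volume,
          ‖hφ.toLp‖ = 1 ∧ hφ.toLp ∈ eigenspace L (-(μ₀ : ℂ) ^ 2)) ∧
        (∃ C, ∀ x, |deriv φ₀ x / φ₀ x| ≤ C) ∧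
        (U φ₀).adjoint = Ustar φ₀ ∧
        L = opSubConst (opComp (Ustar φ₀) (U φ₀)) ((μ₀ : ℂ) ^ 2) ∧
        L0 μ₀ φ₀ = opSubConst (opComp (U φ₀) (Ustar φ₀)) ((μ₀ : ℂ) ^ 2) ∧
        (∀ x, 0 ≤ V0 μ₀ φ₀ x) ∧
        (∀ z ∈ pointSpectrum (L0 μ₀ φ₀), ∃ r : ℝ, 0 < r ∧ z = r) ∧
        (∀ z ∈ opSpectrum (L0 μ₀ φ₀), ∃ r : ℝ, 0 ≤ r ∧ z = r) ∧
        pointSpectrum (L0 μ₀ φ₀) = pointSpectrum L \ {-(μ₀ : ℂ) ^ 2} := by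
  obtain ⟨μ, φ, hμ, h2, hpos, ⟨hφ, hnorm⟩, ⟨C, hC⟩, hs, hR, hV0⟩ := exists_normalized_groundState
  have hlc : Continuous (logDerivative φ) := hs.continuous
  have hdc : Continuous (deriv (logDerivative φ)) := hs.continuous_deriv (by simp)
  have hVc := contDiff_V.continuous
  have hsq : ∀ x, logDerivative φ x ^ 2 ≤ C ^ 2 := fun x => sq_le_sq' (abs_le.1 (hC x)).1
    (abs_le.1 (hC x)).2
  obtain ⟨M, hM⟩ := exists_isMulBy hlc.measurable hC
  obtain ⟨M', hM'⟩ := exists_isMulBy hdc.measurable (C := 9 / 4 + μ ^ 2 + C ^ 2) fun x => by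
    have h1 := abs_le.1 (abs_V_le x)
    have h3 := hsq x
    have h4 := sq_nonneg μ
    have h5 := sq_nonneg (logDerivative φ x)
    rw [hR x, abs_le]
    constructor <;> linarith
  obtain ⟨N, hN⟩ := exists_isMulBy hVc.measurable abs_V_le
  have hV0eq : ∀ x, V0 μ φ x = 2 * logDerivative φ x ^ 2 - 2 * μ ^ 2 - V x := fun x => rfl
  have hV0c : Continuous (V0 μ φ) := by
    have : V0 μ φ = fun x => 2 * logDerivative φ x ^ 2 - 2 * μ ^ 2 - V x := funext hV0eq
    rw [this]
    fun_prop
  obtain ⟨N₀, hN₀⟩ := exists_isMulBy hV0c.measurable (C := 2 * C ^ 2 + 2 * μ ^ 2 + 9 / 4)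
    fun x => by
      have h1 := abs_le.1 (abs_V_le x)
      have h3 := hsq x
      have h4 := sq_nonneg μ
      rw [abs_of_nonneg (hV0 x), hV0eq]
      linarith
  have hcast : ((μ ^ 2 : ℝ) : ℂ) = (μ : ℂ) ^ 2 := Complex.ofReal_pow μ 2
  have hL : L = opSubConst (opComp (Ustar φ) (U φ)) ((μ : ℂ) ^ 2) := by
    rw [← hcast]
    exact schrodinger_eq_Ustar_U hs hM hM' hN hR
  have hL0 : L0 μ φ = opSubConst (opComp (U φ) (Ustar φ)) ((μ : ℂ) ^ 2) := by
    rw [← hcast]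
    refine schrodinger_eq_U_Ustar hs hM hM' hN₀ fun x => ?_
    rw [hR x, hV0eq]
    ring
  have hpp : ∀ z ∈ pointSpectrum (L0 μ φ), ∃ r : ℝ, 0 < r ∧ z = r :=
    schrodinger_pointSpectrum_pos hN₀ hV0
  have hne : ∀ z ∈ pointSpectrum (L0 μ φ), z ≠ -(μ : ℂ) ^ 2 := by
    rintro z hz rfl
    obtain ⟨r, hr, he⟩ := hpp _ hz
    rw [← hcast, ← Complex.ofReal_neg] at he
    have := Complex.ofReal_injective he
    nlinarith [sq_nonneg μ]
  have hswap : pointSpectrum (L0 μ φ) = pointSpectrum L \ {-(μ : ℂ) ^ 2} := by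
    ext z
    constructor
    · intro hz
      refine ⟨?_, hne z hz⟩
      have h1 := hne z hz
      rw [hL0] at hz
      rw [hL]
      exact pointSpectrum_opComp_swap h1 hz
    · rintro ⟨hz, h1⟩
      rw [hL] at hz
      rw [hL0]
      exact pointSpectrum_opComp_swap h1 hz
  -- U*Uu = 0 gives ‖Uu‖² = ⟨U*Uu, u⟩ = 0, so the eigenspace is the kernel of U.
  have hker : ∀ u : L2, u ∈ eigenspace L (-(μ : ℂ) ^ 2) ↔ IsWeakDeriv u (M u) := by
    intro u
    rw [mem_eigenspace_iff_graph, hL, mem_opSubConst_graph_iff, ← add_smul, neg_add_cancel,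
      zero_smul]
    constructor
    · intro h
      obtain ⟨v, huv, -, hv⟩ := inner_eq_of_mem_opComp_graph (U_graph_eq hM) h
      rw [inner_zero_left] at hv
      obtain ⟨w, hw, rfl⟩ := (mem_U_graph_iff hM _ _).1 huv
      rw [← sub_eq_zero.1 (inner_self_eq_zero.1 hv.symm)]
      exact hw
    · intro h
      refine (mem_opComp_graph_iff _ _ _ _).2 ⟨0, (mem_U_graph_iff hM _ _).2
        ⟨M u, h, (sub_self _).symm⟩, Submodule.zero_mem _⟩
  have hmem : hφ.toLp ∈ eigenspace L (-(μ : ℂ) ^ 2) :=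
    (hker _).2 (isWeakDeriv_toLp_self h2 hpos hM hC hφ)
  have hφ0 : hφ.toLp ≠ 0 := by
    intro h0
    rw [h0, norm_zero] at hnorm
    exact zero_ne_one hnorm
  refine ⟨μ, hμ, ?_, ?_, φ, h2, hpos, ⟨hφ, hnorm, hmem⟩, ⟨C, hC⟩, U_adjoint_eq hM, hL, hL0, hV0, hpp,
    ?_, hswap⟩
  · ext r
    simp only [Set.mem_ofPred_eq, Set.mem_singleton_iff]
    constructor
    · rintro ⟨hr, hrL⟩
      by_contra hcon
      -- Another negative eigenvalue of L would be an eigenvalue of L₀, and those are positive.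
      have : (r : ℂ) ∈ pointSpectrum (L0 μ φ) := by
        rw [hswap]
        refine ⟨hrL, fun h => hcon ?_⟩
        rw [Set.mem_singleton_iff, ← hcast, ← Complex.ofReal_neg] at h
        exact Complex.ofReal_injective h
      obtain ⟨r', hr', he⟩ := hpp _ this
      have := Complex.ofReal_injective he
      linarith
    · rintro rfl
      refine ⟨by nlinarith [pow_pos hμ 2], hφ.toLp, ?_, hφ0⟩
      rw [Complex.ofReal_neg, hcast]
      exact hmem
  · refine finrank_eq_one (⟨hφ.toLp, hmem⟩ : eigenspace L (-(μ : ℂ) ^ 2)) ?_ ?_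
    · intro h
      exact hφ0 (congrArg Subtype.val h)
    · rintro ⟨u, hu⟩
      obtain ⟨c, hc⟩ := eq_smul_of_isWeakDeriv_logDerivative h2 hpos hM hφ ((hker u).1 hu)
      exact ⟨c, Subtype.ext hc⟩
  · rw [hL0, ← hcast]
    refine opSpectrum_subset_nonneg (Ustar_graph_eq hM) (U_graph_eq hM) (sq_nonneg μ)
      fun u w huw => ?_
    rw [hcast, ← hL0] at huw
    exact schrodinger_re_inner_nonneg hN₀ hV0 huw
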